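/- Let $B_k(x)$ be the Bernoulli polynomials, defined by $\frac{ze^{xz}}{e^z-1}=\sum_{k\ge 0}\frac{B_k(x)}{k!}z^k$, let $B_k=B_k(0)$ be the Bernoulli numbers, and let $\widetilde B_k$ be the periodic Bernoulli functions: $\widetilde B_k$ has period $1$, and for $t\in[0,1)$ one has $\widetilde B_k(t)=B_k(t)$, except that $\widetilde B_1(0)=0$. For $n\ge 1$ let $I_n$ be the set of $(q;p_1,\dots,p_{n-1})\in\mathbb Z_{>0}^n$ such that every $p_i$ satisfies $p_i<q$ and is relatively prime to $q$. For $r=(r_1,\dots,r_n)\in\mathbb Z_{>0}^n$ and $(q;p_1,\dots,p_{n-1})\in I_n$ define the generalized Dedekind sum $$s_r(q;p_1,\dots,p_{n-1})=\sum_{k_1,\dots,k_{n-1}\in\mathbb Z/q\mathbb Z}\widetilde B_{r_1}\!\left(\tfrac{k_1}{q}\right)\cdots\widetilde B_{r_{n-1}}\!\left(\tfrac{k_{n-1}}{q}\right)\widetilde B_{r_n}\!\left(\tfrac{p_1k_1+\cdots+p_{n-1}k_{n-1}}{q}\right)$$ (for $n=1$ this is $s_{r_1}(q)=\widetilde B_{r_1}(0)$).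 For $N\ge 0$ let $d_{N,n}$ be the least common multiple of the denominators (in lowest terms) of the coefficients of the $N$-th Todd polynomial in $n$ variables, $$\operatorname{Todd}^N(x_1,\dots,x_n)=(-1)^N\sum_{\substack{a_1,\dots,a_n\ge 0\\ a_1+\cdots+a_n=N}}\frac{B_{a_1}\cdots B_{a_n}}{a_1!\cdots a_n!}\,x_1^{a_1}\cdots x_n^{a_n},$$ which is the homogeneous part of total degree $N$ of $\prod_{i=1}^n\frac{x_i}{1-e^{-x_i}}$. Let $n\ge 1$, let $r=(r_1,\dots,r_n)\in\mathbb Z_{>0}^n$ and put $N=r_1+\cdots+r_n$. Then for every $(q;p_1,\dots,p_{n-1})\in I_n$ the number $$\frac{d_{N,n}}{r_1!\cdots r_n!}\;q^{\,N-n+1}\;s_r(q;p_1,\dots,p_{n-1})$$ is an integer. -/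

import Mathlib

/-- The `k`-th periodic Bernoulli function at rational arguments: it has period `1`, it equals the
Bernoulli polynomial `B_k` on `[0, 1)`, except that the first one vanishes at the integers. -/
noncomputable def periodicBernoulli (k : ℕ) (t : ℚ) : ℚ :=
  if k = 1 ∧ Int.fract t = 0 then 0 else (Polynomial.bernoulli k).eval (Int.fract t)

/-- The generalized Dedekind sum `s_r(q; p_1, …, p_m)` of index `r = (r_1, …, r_{m+1})`, in dimension
`n = m + 1`. The summation variables `k_1, …, k_m` run over the representatives `0, …, q - 1` of the
residue classes modulo `q`. For `m = 0` there is one (empty) tuple `k`, and the sum is the value at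
`0` of the periodic Bernoulli function of index `r_1`. -/
noncomputable def generalizedDedekindSum {m : ℕ} (r : Fin (m + 1) → ℕ) (q : ℕ) (p : Fin m → ℤ) : ℚ :=
  ∑ k : Fin m → Fin q,
    (∏ i : Fin m, periodicBernoulli (r i.castSucc) (((k i : ℕ) : ℚ) / (q : ℚ))) *
      periodicBernoulli (r (Fin.last m))
        ((∑ i : Fin m, (p i : ℚ) * ((k i : ℕ) : ℚ)) / (q : ℚ))

/-- The `N`-th Todd polynomial in `n` variables, that is, the homogeneous part of degree `N` of
`∏ x_i / (1 - exp (-x_i))`: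
`(-1)^N * ∑_{|a| = N} (B_{a_1} ⋯ B_{a_n}) / (a_1! ⋯ a_n!) * x_1^{a_1} ⋯ x_n^{a_n}`. -/
noncomputable def toddPolynomial (n N : ℕ) : MvPolynomial (Fin n) ℚ :=
  ∑ a ∈ Finset.finsuppAntidiag (Finset.univ : Finset (Fin n)) N,
    MvPolynomial.monomial a ((-1 : ℚ) ^ N * ∏ i : Fin n, bernoulli (a i) / ((a i).factorial : ℚ))

/-- `d_{N,n}`: the least common multiple of the denominators (in lowest terms) of the coefficients
of the `N`-th Todd polynomial in `n` variables. -/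
noncomputable def toddDenominator (N n : ℕ) : ℕ :=
  (toddPolynomial n N).support.lcm fun a => ((toddPolynomial n N).coeff a).den

/-- The set `I_n` for `n = m + 1`: all `(q; p_1, …, p_m)` of positive integers such that each `p_i`
is less than `q` and relatively prime to `q`. -/
def dedekindParameters (m : ℕ) : Set (ℕ × (Fin m → ℤ)) :=
  {x | 0 < x.1 ∧ ∀ i : Fin m, 0 < x.2 i ∧ x.2 i < (x.1 : ℤ) ∧ IsCoprime (x.2 i) (x.1 : ℤ)}

/-! The sum is read off from the generating function of a lattice cone. Let `L` be the kernel of the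
form `p_1 k_1 + ⋯ + p_m k_m - k_n` modulo `q`, and take the orthant with generators `q e_i`. The sum
of `X^x` over its points of `L` is a sum over the box `0 ≤ x_i < q`, divided by `∏ (1 - X_i^q)`
(`slabSeries_mul_prod_eq_sum_latticeBox`). Under `X_i ↦ exp (t X_i)`, the part of degree `N - n` has
as coefficients, up to sign and a power of `q`, the sums over the box of `∏ B_{r_i}(x_i/q) / r_i!`.

The same series is an integral combination of series `1 / ∏ (1 - X^v)` of unimodular cones of `L`
(`slabSeries_mem_closure_unimodular`). For such a cone this part is a Todd polynomial in the linear
forms `l_v`, divided by `∏ l_v`. Writing each `l_v` as its content times a primitive form, the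
contents multiply to a divisor of the index of `L`, hence of `q` (`prod_vectorContent_dvd_card`). So
`d_{N,n} q` clears all numerical denominators and only primitive forms remain below. These forms
cancel in the total, and by Gauss's lemma (`exists_eq_map_of_mul_linearForm`) their cancellation
introduces no new denominators; this gives `exists_eq_map_coeff_latticeBox` and
`exists_int_sum_latticeBox`.

The convention that the first periodic function vanishes at integers adds `1/2` to `B_1(0)`.
Expanding the product turns these corrections into the same sums over faces of the orthant. Their
powers of `1/2` are absorbed because `B_1 = -1/2` already occurs in Todd coefficients
(`clearsTodd_toddDenominator`). -/

/-- A finite set of vectors with natural coordinates is linearly independent over `ℚ`. -/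
def IndepVectors {ι : Type*} (S : Finset (ι →₀ ℕ)) : Prop :=
  ∀ c : (ι →₀ ℕ) → ℚ, (∀ i, ∑ v ∈ S, c v * (v i : ℚ) = 0) → ∀ v ∈ S, c v = 0

/-- The points of the lattice `ker φ` in the cone spanned by `S` whose coefficients at the vectors
in `T` are smaller than `1`. -/
def coneSlab {ι G : Type*} [AddCommGroup G] (φ : (ι →₀ ℕ) →+ G) (S T : Finset (ι →₀ ℕ)) :
    Set (ι →₀ ℕ) :=
  {x | φ x = 0 ∧ ∃ c : (ι →₀ ℕ) → ℚ, (∀ v ∈ S, 0 ≤ c v) ∧ (∀ v ∈ T, c v < 1) ∧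
    ∀ i, ∑ v ∈ S, c v * (v i : ℚ) = (x i : ℚ)}

open scoped Classical in
/-- The generating function of `coneSlab φ S T`. -/
noncomputable def slabSeries {ι G : Type*} [AddCommGroup G] (φ : (ι →₀ ℕ) →+ G)
    (S T : Finset (ι →₀ ℕ)) : MvPowerSeries ι ℤ :=
  fun x => if x ∈ coneSlab φ S T then 1 else 0

open scoped Classical in
/-- The lattice points of the half-open parallelepiped spanned by `S`. -/
noncomputable def latticeBox {ι G : Type*} [Fintype ι] [AddCommGroup G] (φ : (ι →₀ ℕ) →+ G)
    (S : Finset (ι →₀ ℕ)) : Finset (ι →₀ ℕ) :=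
  (Finset.Iic (∑ v ∈ S, v)).filter (· ∈ coneSlab φ S S)

/-! ### Simplicial lattice cones: the generating function as box over denominator. -/

section Cones

variable {ι G : Type*} [AddCommGroup G] {φ : (ι →₀ ℕ) →+ G} {S T : Finset (ι →₀ ℕ)}

theorem IndepVectors.eq_of_sum_eq (hS : IndepVectors S) {c d : (ι →₀ ℕ) → ℚ}
    (h : ∀ i, ∑ v ∈ S, c v * (v i : ℚ) = ∑ v ∈ S, d v * (v i : ℚ)) : ∀ v ∈ S, c v = d v := by
  intro v hv
  have := hS (fun v => c v - d v) (fun i => by simp [sub_mul, h i]) v hv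
  simpa [sub_eq_zero] using this

theorem IndepVectors.ne_zero (hS : IndepVectors S) {v : ι →₀ ℕ} (hv : v ∈ S) : v ≠ 0 := by
  classical
  rintro rfl
  have := hS (fun v => if v = 0 then 1 else 0) (fun i => by simp) 0 hv
  simp at this

theorem coeff_slabSeries (x : ι →₀ ℕ) [Decidable (x ∈ coneSlab φ S T)] :
    MvPowerSeries.coeff x (slabSeries φ S T) = if x ∈ coneSlab φ S T then 1 else 0 := by
  rw [MvPowerSeries.coeff_apply]
  unfold slabSeries
  congr

theorem mem_latticeBox [Fintype ι] {x : ι →₀ ℕ} : x ∈ latticeBox φ S ↔ x ∈ coneSlab φ S S := by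
  classical
  simp only [latticeBox, Finset.mem_filter, Finset.mem_Iic, and_iff_right_iff_imp]
  rintro ⟨-, c, h0, h1, hc⟩ i
  have : (x i : ℚ) ≤ ((∑ v ∈ S, v) i : ℕ) := by
    rw [← hc i, Finsupp.finsetSum_apply]
    push_cast
    refine Finset.sum_le_sum fun v hv => ?_
    nlinarith [h1 v hv, h0 v hv, (Nat.cast_nonneg (v i) : (0 : ℚ) ≤ v i)]
  exact_mod_cast this

/-- By independence the coefficients of a point are unique, and adding `v` raises only the one at
`v`, by exactly one. -/
theorem add_mem_coneSlab_iff (hS : IndepVectors S) (hφ : ∀ v ∈ S, φ v = 0) {v : ι →₀ ℕ}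
    (hv : v ∈ S) (hvT : v ∉ T) (y : ι →₀ ℕ) (c : (ι →₀ ℕ) → ℚ)
    (hc : ∀ i, ∑ u ∈ S, c u * (u i : ℚ) = ((y + v) i : ℕ)) :
    y ∈ coneSlab φ S T ↔ y + v ∈ coneSlab φ S T ∧ 1 ≤ c v := by
  classical
  have key (d : (ι →₀ ℕ) → ℚ) (i : ι) :
      ∑ u ∈ S, (d u + if u = v then 1 else 0) * (u i : ℚ) = ∑ u ∈ S, d u * (u i : ℚ) + v i := by
    simp [add_mul, Finset.sum_add_distrib, hv]
  constructor
  · rintro ⟨hy, d, h0, h1, hd⟩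
    have hd' : ∀ i, ∑ u ∈ S, (d u + if u = v then 1 else 0) * (u i : ℚ) = ((y + v) i : ℕ) := by
      intro i; rw [key, hd]; push_cast [Finsupp.add_apply]; rfl
    refine ⟨⟨by rw [map_add, hy, hφ v hv, add_zero], _, ?_, ?_, hd'⟩, ?_⟩
    · intro u hu
      have := h0 u hu
      split_ifs <;> linarith
    · intro u hu
      have := h1 u hu
      have : u ≠ v := fun h => hvT (h ▸ hu)
      simpa [this]
    · have := hS.eq_of_sum_eq (fun i => (hc i).trans (hd' i).symm) v hv
      rw [this]
      simpa using h0 v hv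
  · rintro ⟨⟨hy, d, h0, h1, hd⟩, hcv⟩
    have e := hS.eq_of_sum_eq (fun i => (hc i).trans (hd i).symm)
    refine ⟨by simpa [hφ v hv] using hy, fun u => d u - if u = v then 1 else 0, ?_, ?_, ?_⟩
    · intro u hu
      have := h0 u hu
      have := e v hv
      dsimp only
      split_ifs with h
      · subst h; linarith
      · linarith
    · intro u hu
      have := h1 u hu
      have : u ≠ v := fun h => hvT (h ▸ hu)
      simpa [this]
    · intro i
      have := key (fun u => d u - if u = v then 1 else 0) i
      simp only [sub_add_cancel] at this
      rw [hd i] at this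
      push_cast [Finsupp.add_apply] at this
      linarith

/-- The translate of the slab by `v` consists of its points with coefficient at least `1` at `v`;
subtracting it truncates that coefficient to `[0, 1)`. -/
theorem slabSeries_mul_one_sub [DecidableEq (ι →₀ ℕ)] (hS : IndepVectors S)
    (hφ : ∀ v ∈ S, φ v = 0) {v : ι →₀ ℕ} (hv : v ∈ S) (hvT : v ∉ T) :
    slabSeries φ S T * (1 - MvPowerSeries.monomial v 1) = slabSeries φ S (insert v T) := by
  classical
  ext x
  rw [mul_sub, mul_one, map_sub, MvPowerSeries.coeff_mul_monomial, coeff_slabSeries,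
    coeff_slabSeries, coeff_slabSeries, mul_one]
  have hsub : x ∈ coneSlab φ S (insert v T) → x ∈ coneSlab φ S T := by
    rintro ⟨h, c, h0, h1, hc⟩
    exact ⟨h, c, h0, fun u hu => h1 u (Finset.mem_insert_of_mem hu), hc⟩
  by_cases hx : x ∈ coneSlab φ S T
  · obtain ⟨h, c, h0, h1, hc⟩ := id hx
    by_cases hcv : c v < 1
    · have hx' : x ∈ coneSlab φ S (insert v T) := by
        refine ⟨h, c, h0, ?_, hc⟩
        intro u hu
        rcases Finset.mem_insert.1 hu with rfl | hu
        exacts [hcv, h1 u hu]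
      have : ¬ (v ≤ x ∧ x - v ∈ coneSlab φ S T) := by
        rintro ⟨hle, hmem⟩
        have := (add_mem_coneSlab_iff hS hφ hv hvT (x - v) c
          (by rwa [tsub_add_cancel_of_le hle])).1 hmem
        linarith [this.2]
      rw [not_and] at this
      rw [if_pos hx, if_pos hx']
      split_ifs with h1 h2
      · exact absurd h2 (this h1)
      all_goals simp
    · have hle : v ≤ x := by
        intro i
        have : (v i : ℚ) ≤ x i := by
          rw [← hc i]
          calc (v i : ℚ) ≤ c v * v i := by
                nlinarith [(Nat.cast_nonneg (v i) : (0 : ℚ) ≤ v i)]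
            _ ≤ _ := Finset.single_le_sum (f := fun u => c u * (u i : ℚ))
                (fun u hu => mul_nonneg (h0 u hu) (Nat.cast_nonneg _)) hv
        exact_mod_cast this
      have hmem : x - v ∈ coneSlab φ S T :=
        (add_mem_coneSlab_iff hS hφ hv hvT (x - v) c
          (by rwa [tsub_add_cancel_of_le hle])).2
          ⟨by rwa [tsub_add_cancel_of_le hle], not_lt.1 hcv⟩
      have hx' : x ∉ coneSlab φ S (insert v T) := by
        rintro ⟨-, d, -, h1', hd⟩
        have := hS.eq_of_sum_eq (fun i => (hc i).trans (hd i).symm) v hv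
        exact hcv (this ▸ h1' v (Finset.mem_insert_self _ _))
      rw [if_pos hx, if_pos hle, if_pos hmem, if_neg hx', sub_self]
  · rw [if_neg hx, if_neg (fun h => hx (hsub h))]
    split_ifs with hle hmem
    · exfalso
      obtain ⟨h, d, h0, h1, hd⟩ := id hmem
      refine hx ?_
      have := (add_mem_coneSlab_iff hS hφ hv hvT (x - v)
        (fun u => d u + if u = v then 1 else 0) (fun i => ?_)).1 hmem
      · rw [tsub_add_cancel_of_le hle] at this
        exact this.1
      · simp only [add_mul, Finset.sum_add_distrib, hd i]
        push_cast [Finsupp.add_apply]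
        simp [hv]
    all_goals simp

theorem slabSeries_mul_prod (hS : IndepVectors S) (hφ : ∀ v ∈ S, φ v = 0) (hT : T ⊆ S) :
    slabSeries φ S ∅ * ∏ v ∈ T, (1 - MvPowerSeries.monomial v 1) = slabSeries φ S T := by
  classical
  induction T using Finset.induction_on with
  | empty => simp
  | insert v T hv ih =>
    rw [Finset.prod_insert hv, mul_comm (1 - _), ← mul_assoc,
      ih ((Finset.subset_insert _ _).trans hT)]
    exact slabSeries_mul_one_sub hS hφ (hT (Finset.mem_insert_self _ _)) hv

theorem slabSeries_mul_prod_eq_sum_latticeBox [Fintype ι] (hS : IndepVectors S)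
    (hφ : ∀ v ∈ S, φ v = 0) :
    slabSeries φ S ∅ * ∏ v ∈ S, (1 - MvPowerSeries.monomial v 1) =
      ∑ x ∈ latticeBox φ S, MvPowerSeries.monomial x 1 := by
  classical
  rw [slabSeries_mul_prod hS hφ subset_rfl]
  ext x
  rw [coeff_slabSeries, map_sum]
  simp only [MvPowerSeries.coeff_monomial, Finset.sum_ite_eq, mem_latticeBox]

end Cones

/-! ### Star subdivision and reduction to unimodular cones. -/

section Subdivision

variable {ι G : Type*} [AddCommGroup G] {φ : (ι →₀ ℕ) →+ G} {S I : Finset (ι →₀ ℕ)}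
  {w : ι →₀ ℕ} {α : (ι →₀ ℕ) → ℚ}

/-- Substituting the expansion of `w` converts coefficients for the new generators into coefficients
for `S`, where independence can be applied. -/
theorem sum_insert_sdiff [DecidableEq (ι →₀ ℕ)] (hw : w ∉ S)
    (hα : ∀ i, ∑ v ∈ S, α v * (v i : ℚ) = w i) (c : (ι →₀ ℕ) → ℚ) (i : ι) :
    ∑ u ∈ insert w (S \ I), c u * (u i : ℚ) =
      ∑ v ∈ S, (c w * α v + if v ∈ I then 0 else c v) * (v i : ℚ) := by
  rw [Finset.sum_insert (fun h => hw (Finset.mem_sdiff.1 h).1), ← hα i, Finset.mul_sum]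
  simp only [add_mul, Finset.sum_add_distrib, mul_assoc]
  congr 1
  rw [Finset.sdiff_eq_filter, Finset.sum_filter]
  refine Finset.sum_congr rfl fun v _ => ?_
  split_ifs <;> simp_all

theorem IndepVectors.notMem_of_coeff_lt_one (hS : IndepVectors S)
    (hα : ∀ i, ∑ v ∈ S, α v * (v i : ℚ) = w i) (h1 : ∀ v ∈ S, α v < 1) : w ∉ S := by
  classical
  intro hw
  have := hS.eq_of_sum_eq (c := α) (d := fun v => if v = w then 1 else 0)
    (fun i => by simp [hα, hw]) w hw
  simp only [if_true] at this
  linarith [h1 w hw]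

theorem IndepVectors.insert_sdiff [DecidableEq (ι →₀ ℕ)] (hS : IndepVectors S) (hw : w ∉ S)
    (hα : ∀ i, ∑ v ∈ S, α v * (v i : ℚ) = w i) (hI : ∀ v ∈ I, v ∈ S ∧ 0 < α v)
    (hne : I.Nonempty) : IndepVectors (insert w (S \ I)) := by
  intro c hc
  have h := hS _ (fun i => (sum_insert_sdiff hw hα c i).symm.trans (hc i))
  obtain ⟨u, hu⟩ := hne
  have hcw : c w = 0 := by
    have := h u (hI u hu).1
    simp only [hu, if_true, add_zero, mul_eq_zero] at this
    exact this.resolve_right (hI u hu).2.ne'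
  intro v hv
  rcases Finset.mem_insert.1 hv with rfl | hv
  · exact hcw
  · obtain ⟨hvS, hvI⟩ := Finset.mem_sdiff.1 hv
    simpa [hcw, hvI] using h v hvS

/-- A point of the cone over `S`, written with coefficients `c`, lies in the cone obtained by
replacing the vectors of `I` by `w` iff the ratios `c v / α v` are minimal at all `v ∈ I`. -/
theorem mem_coneSlab_insert_sdiff_iff [DecidableEq (ι →₀ ℕ)] (hS : IndepVectors S) (hw : w ∉ S)
    (hα : ∀ i, ∑ v ∈ S, α v * (v i : ℚ) = w i)
    (hI : ∀ v ∈ I, v ∈ S ∧ 0 < α v) (hne : I.Nonempty) {x : ι →₀ ℕ} (hx : φ x = 0)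
    {c : (ι →₀ ℕ) → ℚ} (hc : ∀ i, ∑ v ∈ S, c v * (v i : ℚ) = x i) (hc0 : ∀ v ∈ S, 0 ≤ c v) {μ : ℚ}
    (hμ : ∀ v ∈ S, μ * α v ≤ c v) (hμ' : ∃ v ∈ S, 0 < α v ∧ c v = μ * α v) :
    x ∈ coneSlab φ (insert w (S \ I)) ∅ ↔ ∀ v ∈ I, c v = μ * α v := by
  constructor
  · rintro ⟨-, d, hd0, -, hd⟩
    have e := hS.eq_of_sum_eq (fun i => (hc i).trans ((hd i).symm.trans (sum_insert_sdiff hw hα d i)))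
    -- At a vector attaining the minimal ratio the remaining coefficient is nonnegative, which
    -- bounds `d w` above; at a vector of `I` it is absent, which bounds `d w` below.
    have hdμ : d w = μ := by
      apply le_antisymm
      · obtain ⟨v, hv, hpos, hcv⟩ := hμ'
        have h := e v hv
        rw [hcv] at h
        have : 0 ≤ (if v ∈ I then 0 else d v) := by
          split_ifs with hvI
          · exact le_rfl
          · exact hd0 v (Finset.mem_insert_of_mem (Finset.mem_sdiff.2 ⟨hv, hvI⟩))
        exact le_of_mul_le_mul_right (by linarith) hpos
      · obtain ⟨v, hv⟩ := hne
        have h := e v (hI v hv).1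
        simp only [hv, if_true, add_zero] at h
        exact le_of_mul_le_mul_right (h ▸ hμ v (hI v hv).1) (hI v hv).2
    intro v hv
    rw [e v (hI v hv).1]
    simp [hv, hdμ]
  · intro h
    refine ⟨hx, fun v => if v = w then μ else c v - μ * α v, ?_, by simp, ?_⟩
    · intro v hv
      rcases Finset.mem_insert.1 hv with rfl | hv
      · obtain ⟨v, hv, hpos, hcv⟩ := hμ'
        simp only [if_true]
        have := hc0 v hv
        rw [hcv] at this
        exact nonneg_of_mul_nonneg_left this hpos
      · obtain ⟨hvS, -⟩ := Finset.mem_sdiff.1 hv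
        have : v ≠ w := fun h => hw (h ▸ hvS)
        simpa [this] using hμ v hvS
    · intro i
      rw [sum_insert_sdiff hw hα, ← hc i]
      refine Finset.sum_congr rfl fun v hv => ?_
      have hvw : v ≠ w := fun h => hw (h ▸ hv)
      by_cases hvI : v ∈ I
      · simp [hvI, h v hvI]
      · simp [hvI, hvw]

theorem coneSlab_insert_sdiff_subset [DecidableEq (ι →₀ ℕ)] (hw : w ∉ S)
    (hα : ∀ i, ∑ v ∈ S, α v * (v i : ℚ) = w i) (h0 : ∀ v ∈ S, 0 ≤ α v) :
    coneSlab φ (insert w (S \ I)) ∅ ⊆ coneSlab φ S ∅ := by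
  rintro x ⟨hx, d, hd0, -, hd⟩
  refine ⟨hx, _, ?_, by simp, fun i => (sum_insert_sdiff hw hα d i).symm.trans (hd i)⟩
  intro v hv
  have h1 := mul_nonneg (hd0 w (Finset.mem_insert_self _ _)) (h0 v hv)
  split_ifs with hvI
  · simpa using h1
  · exact add_nonneg h1 (hd0 v (Finset.mem_insert_of_mem (Finset.mem_sdiff.2 ⟨hv, hvI⟩)))

/-- Star subdivision of a simplicial cone, with inclusion-exclusion over the pieces. -/
theorem slabSeries_eq_sum_insert_sdiff [DecidableEq (ι →₀ ℕ)] (hS : IndepVectors S) (hw : w ∉ S)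
    (hw0 : w ≠ 0) (hα : ∀ i, ∑ v ∈ S, α v * (v i : ℚ) = w i) (h0 : ∀ v ∈ S, 0 ≤ α v) :
    slabSeries φ S ∅ = -∑ I ∈ (S.filter (0 < α ·)).powerset.erase ∅,
      (-1 : ℤ) ^ I.card • slabSeries φ (insert w (S \ I)) ∅ := by
  classical
  ext x
  simp only [map_neg, map_sum, map_zsmul, coeff_slabSeries]
  by_cases hx : x ∈ coneSlab φ S ∅
  · obtain ⟨hxφ, c, hc0, -, hc⟩ := id hx
    have hP : (S.filter (0 < α ·)).Nonempty := by
      by_contra h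
      rw [Finset.not_nonempty_iff_eq_empty, Finset.filter_eq_empty_iff] at h
      refine hw0 (Finsupp.ext fun i => ?_)
      have := hα i
      rw [Finset.sum_eq_zero fun v hv => by
        rw [le_antisymm (not_lt.1 (h hv)) (h0 v hv), zero_mul]] at this
      simpa using this.symm
    obtain ⟨u, hu, hmin⟩ := Finset.exists_min_image _ (fun v => c v / α v) hP
    set μ := c u / α u with hμdef
    have hμ : ∀ v ∈ S, μ * α v ≤ c v := by
      intro v hv
      rcases (h0 v hv).eq_or_lt with h | h
      · simpa [← h] using hc0 v hv
      · exact (le_div_iff₀ h).1 (hmin v (Finset.mem_filter.2 ⟨hv, h⟩))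
    have huα := (Finset.mem_filter.1 hu).2
    have hμ' : c u = μ * α u := by rw [hμdef]; field_simp
    -- `M` is where the ratio `c v / α v` is minimal. Only pieces with `I ⊆ M` contain `x`, and the
    -- alternating sum over all subsets of `M` vanishes, so omitting `∅` leaves `-1`.
    set M := (S.filter (0 < α ·)).filter fun v => c v = μ * α v with hM
    have huM : u ∈ M := Finset.mem_filter.2 ⟨hu, hμ'⟩
    have hiff : ∀ I ∈ (S.filter (0 < α ·)).powerset.erase ∅,
        (x ∈ coneSlab φ (insert w (S \ I)) ∅ ↔ I ⊆ M) := by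
      intro I hI
      obtain ⟨hIne, hI⟩ := Finset.mem_erase.1 hI
      rw [Finset.mem_powerset] at hI
      rw [mem_coneSlab_insert_sdiff_iff hS hw hα (fun v hv => Finset.mem_filter.1 (hI hv))
        (Finset.nonempty_iff_ne_empty.2 hIne) hxφ hc hc0 hμ
        ⟨u, (Finset.mem_filter.1 hu).1, huα, hμ'⟩]
      exact ⟨fun h v hv => Finset.mem_filter.2 ⟨hI hv, h v hv⟩,
        fun h v hv => (Finset.mem_filter.1 (h hv)).2⟩
    have hsum : ∑ I ∈ (S.filter (0 < α ·)).powerset.erase ∅,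
        (-1 : ℤ) ^ I.card • (if x ∈ coneSlab φ (insert w (S \ I)) ∅ then (1 : ℤ) else 0) =
        ∑ I ∈ M.powerset.erase ∅, (-1 : ℤ) ^ I.card := by
      rw [Finset.sum_congr rfl fun I hI => by rw [if_congr (hiff I hI) rfl rfl]]
      simp only [smul_eq_mul, mul_ite, mul_one, mul_zero]
      rw [← Finset.sum_filter]
      refine Finset.sum_congr ?_ fun _ _ => rfl
      ext I
      simp only [Finset.mem_filter, Finset.mem_erase, Finset.mem_powerset]
      exact ⟨fun h => ⟨h.1.1, h.2⟩, fun h => ⟨⟨h.1, h.2.trans (Finset.filter_subset _ _)⟩, h.2⟩⟩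
    rw [hsum, if_pos hx, Finset.sum_erase_eq_sub (Finset.empty_mem_powerset M),
      Finset.sum_powerset_neg_one_pow_card_of_nonempty ⟨u, huM⟩]
    simp
  · rw [if_neg hx, Finset.sum_eq_zero, neg_zero]
    intro I _
    rw [if_neg fun h => hx (coneSlab_insert_sdiff_subset hw hα h0 h), smul_zero]

/-- Reducing the coefficients over `S` modulo `1` injects the new box into the old one. It misses
`w`: at `u ∈ I` the coefficient is `b * α u` with `b < 1`, hence smaller than `α u`. -/
theorem card_latticeBox_insert_sdiff_lt [Fintype ι] [DecidableEq (ι →₀ ℕ)] (hS : IndepVectors S)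
    (hφ : ∀ v ∈ S, φ v = 0) (hw : w ∈ latticeBox φ S)
    (hα : ∀ i, ∑ v ∈ S, α v * (v i : ℚ) = w i) (h0 : ∀ v ∈ S, 0 ≤ α v) (h1 : ∀ v ∈ S, α v < 1)
    (hI : ∀ v ∈ I, v ∈ S ∧ 0 < α v) (hne : I.Nonempty) :
    (latticeBox φ (insert w (S \ I))).card < (latticeBox φ S).card := by
  have hwS := hS.notMem_of_coeff_lt_one hα h1
  obtain ⟨u, hu⟩ := hne
  have key : ∀ x, ∃ y, x ∈ latticeBox φ (insert w (S \ I)) →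
      φ y = 0 ∧ ∃ c : (ι →₀ ℕ) → ℚ, (∀ v ∈ insert w (S \ I), 0 ≤ c v ∧ c v < 1) ∧
        (∀ i, ∑ v ∈ insert w (S \ I), c v * (v i : ℚ) = x i) ∧
        ∀ i, ∑ v ∈ S, Int.fract (c w * α v + if v ∈ I then 0 else c v) * (v i : ℚ) = y i := by
    intro x
    by_cases hx : x ∈ latticeBox φ (insert w (S \ I))
    swap
    · exact ⟨0, fun h => absurd h hx⟩
    obtain ⟨hxφ, c, hc0, hc1, hc⟩ := mem_latticeBox.1 hx
    set e : (ι →₀ ℕ) → ℚ := fun v => c w * α v + if v ∈ I then 0 else c v with he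
    have hsum : ∀ i, ∑ v ∈ S, e v * (v i : ℚ) = x i :=
      fun i => (sum_insert_sdiff hwS hα c i).symm.trans (hc i)
    have he0 : ∀ v ∈ S, 0 ≤ e v := by
      intro v hv
      have h1 := mul_nonneg (hc0 w (Finset.mem_insert_self _ _)) (h0 v hv)
      simp only [he]
      split_ifs with hvI
      · simpa using h1
      · exact add_nonneg h1 (hc0 v (Finset.mem_insert_of_mem (Finset.mem_sdiff.2 ⟨hv, hvI⟩)))
    have hfl : ∀ v ∈ S, ((⌊e v⌋₊ : ℕ) : ℚ) = e v - Int.fract (e v) := by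
      intro v hv
      rw [natCast_floor_eq_intCast_floor (he0 v hv), Int.self_sub_fract]
    -- The integral parts can be subtracted inside `ℕ`, so the reduced point again has natural
    -- coordinates.
    have hle : ∑ v ∈ S, ⌊e v⌋₊ • v ≤ x := by
      intro i
      have : (((∑ v ∈ S, ⌊e v⌋₊ • v) i : ℕ) : ℚ) ≤ x i := by
        rw [← hsum i, Finsupp.finsetSum_apply]
        push_cast [Finsupp.smul_apply, smul_eq_mul]
        exact Finset.sum_le_sum fun v hv =>
          mul_le_mul_of_nonneg_right (Nat.floor_le (he0 v hv)) (Nat.cast_nonneg _)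
      exact_mod_cast this
    obtain ⟨y, hy⟩ := le_iff_exists_add'.1 hle
    refine ⟨y, fun _ => ⟨?_, c, fun v hv => ⟨hc0 v hv, hc1 v hv⟩, hc, fun i => ?_⟩⟩
    · have := congrArg φ hy
      rw [map_add, map_sum, Finset.sum_eq_zero fun v hv => by rw [map_nsmul, hφ v hv, smul_zero],
        add_zero, hxφ] at this
      exact this.symm
    · have h2 := hsum i
      rw [hy, Finsupp.add_apply, Finsupp.finsetSum_apply] at h2
      push_cast [Finsupp.smul_apply, smul_eq_mul] at h2
      have h3 : ∑ v ∈ S, (⌊e v⌋₊ : ℚ) * (v i : ℚ) =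
          ∑ v ∈ S, (e v - Int.fract (e v)) * (v i : ℚ) :=
        Finset.sum_congr rfl fun v hv => by rw [hfl v hv]
      rw [h3] at h2
      simp only [sub_mul, Finset.sum_sub_distrib] at h2
      linarith
  choose g hg using key
  have hlt : ∀ b : ℚ, 0 ≤ b → b < 1 → Int.fract (b * α u) = b * α u := by
    intro b hb0 hb1
    refine Int.fract_eq_self.2 ⟨mul_nonneg hb0 (hI u hu).2.le, ?_⟩
    nlinarith [(hI u hu).2, h1 u (hI u hu).1]
  have hmaps : ∀ x ∈ latticeBox φ (insert w (S \ I)), g x ∈ (latticeBox φ S).erase w := by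
    intro x hx
    obtain ⟨hy, c, hc01, hc, hcy⟩ := hg x hx
    refine Finset.mem_erase.2 ⟨?_, mem_latticeBox.2 ⟨hy, _, fun v _ => Int.fract_nonneg _,
      fun v _ => Int.fract_lt_one _, hcy⟩⟩
    intro hxw
    have := hS.eq_of_sum_eq (fun i => (hcy i).trans ((hxw ▸ hα i).symm)) u (hI u hu).1
    obtain ⟨hb0, hb1⟩ := hc01 w (Finset.mem_insert_self _ _)
    simp only [hu, if_true, add_zero] at this
    rw [hlt _ hb0 hb1] at this
    nlinarith [(hI u hu).2]
  have hinj : Set.InjOn g (latticeBox φ (insert w (S \ I)) : Set (ι →₀ ℕ)) := by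
    intro x hx x' hx' hxx
    obtain ⟨-, c, hc01, hc, hcy⟩ := hg x hx
    obtain ⟨-, d, hd01, hd, hdy⟩ := hg x' hx'
    have e := hS.eq_of_sum_eq (fun i => (hcy i).trans ((hxx ▸ hdy i).symm))
    have hcd : c w = d w := by
      have := e u (hI u hu).1
      obtain ⟨hb0, hb1⟩ := hc01 w (Finset.mem_insert_self _ _)
      obtain ⟨hb0', hb1'⟩ := hd01 w (Finset.mem_insert_self _ _)
      simp only [hu, if_true, add_zero] at this
      rw [hlt _ hb0 hb1, hlt _ hb0' hb1'] at this
      exact mul_right_cancel₀ (hI u hu).2.ne' this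
    have hall : ∀ v ∈ insert w (S \ I), c v = d v := by
      intro v hv
      rcases Finset.mem_insert.1 hv with rfl | hv'
      · exact hcd
      · obtain ⟨hvS, hvI⟩ := Finset.mem_sdiff.1 hv'
        have := e v hvS
        simp only [hvI, if_false, hcd] at this
        obtain ⟨z, hz⟩ := Int.fract_eq_fract.1 this
        rw [add_sub_add_left_eq_sub] at hz
        obtain ⟨ha0, ha1⟩ := hc01 v hv
        obtain ⟨hb0, hb1⟩ := hd01 v hv
        have hz1 : (z : ℚ) < 1 := by linarith
        have hz2 : (-1 : ℚ) < z := by linarith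
        have : z = 0 := by
          have h1 : z < 1 := by exact_mod_cast hz1
          have h2 : -1 < z := by exact_mod_cast hz2
          omega
        rw [this, Int.cast_zero, sub_eq_zero] at hz
        exact hz
    ext i
    have := (hc i).symm.trans ((Finset.sum_congr rfl fun v hv => by rw [hall v hv]).trans (hd i))
    exact_mod_cast this
  exact (Finset.card_le_card_of_injOn g hmaps hinj).trans_lt (Finset.card_erase_lt_of_mem hw)

/-- The generating function of a simplicial cone is an integral combination of generating
functions of unimodular cones. -/
theorem slabSeries_mem_closure_unimodular [Fintype ι] (n : ℕ) : ∀ S : Finset (ι →₀ ℕ),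
    (latticeBox φ S).card = n → IndepVectors S → (∀ v ∈ S, φ v = 0) →
    slabSeries φ S ∅ ∈ AddSubgroup.closure
      {g | ∃ U : Finset (ι →₀ ℕ), IndepVectors U ∧ (∀ v ∈ U, φ v = 0) ∧
        (∀ x ∈ latticeBox φ U, x = 0) ∧ U.card ≤ S.card ∧ g = slabSeries φ U ∅} := by
  classical
  induction n using Nat.strong_induction_on with
  | _ n ih =>
    intro S hn hS hφ
    by_cases hbox : ∀ x ∈ latticeBox φ S, x = 0
    · exact AddSubgroup.subset_closure ⟨S, hS, hφ, hbox, le_rfl, rfl⟩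
    push Not at hbox
    obtain ⟨w, hw, hw0⟩ := hbox
    obtain ⟨hwφ, α, h0, h1, hα⟩ := mem_latticeBox.1 hw
    have hwS := hS.notMem_of_coeff_lt_one hα h1
    rw [slabSeries_eq_sum_insert_sdiff hS hwS hw0 hα h0]
    refine neg_mem (sum_mem fun I hI => zsmul_mem ?_ _)
    obtain ⟨hIne, hI⟩ := Finset.mem_erase.1 hI
    have hI' : ∀ v ∈ I, v ∈ S ∧ 0 < α v :=
      fun v hv => Finset.mem_filter.1 (Finset.mem_powerset.1 hI hv)
    have hne := Finset.nonempty_iff_ne_empty.2 hIne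
    have hcard : (insert w (S \ I)).card ≤ S.card := by
      obtain ⟨u, hu⟩ := hne
      refine (Finset.card_insert_le _ _).trans (Nat.succ_le_of_lt (Finset.card_lt_card ?_))
      exact Finset.ssubset_iff_subset_ne.2 ⟨Finset.sdiff_subset, fun h => by
        have := h ▸ (hI' u hu).1
        exact (Finset.mem_sdiff.1 this).2 hu⟩
    refine AddSubgroup.closure_mono ?_ (ih _ (hn ▸ card_latticeBox_insert_sdiff_lt hS hφ hw hα h0 h1
      hI' hne) (insert w (S \ I)) rfl (hS.insert_sdiff hwS hα hI' hne) ?_)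
    · rintro g ⟨U, hU1, hU2, hU3, hU4, rfl⟩
      exact ⟨U, hU1, hU2, hU3, hU4.trans hcard, rfl⟩
    · intro v hv
      rcases Finset.mem_insert.1 hv with rfl | hv
      exacts [hwφ, hφ v (Finset.mem_sdiff.1 hv).1]

end Subdivision

/-! ### Contents of the generators and the index of the lattice. -/

section Content

variable {ι : Type*} [Fintype ι]

/-- The greatest common divisor of the coordinates. -/
def vectorContent (v : ι →₀ ℕ) : ℕ := Finset.univ.gcd fun i => v i

/-- A vector divided by the greatest common divisor of its coordinates. -/
noncomputable def primitivePart (v : ι →₀ ℕ) : ι →₀ ℕ :=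
  v.mapRange (· / vectorContent v) (Nat.zero_div _)

theorem vectorContent_mul_primitivePart (v : ι →₀ ℕ) (i : ι) :
    vectorContent v * primitivePart v i = v i :=
  Nat.mul_div_cancel' (Finset.gcd_dvd (Finset.mem_univ i))

theorem vectorContent_smul_primitivePart (v : ι →₀ ℕ) :
    vectorContent v • primitivePart v = v :=
  Finsupp.ext fun i => vectorContent_mul_primitivePart v i

theorem vectorContent_pos {v : ι →₀ ℕ} (hv : v ≠ 0) : 0 < vectorContent v := by
  refine Nat.pos_of_ne_zero fun h => hv (Finsupp.ext fun i => ?_)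
  rw [← vectorContent_mul_primitivePart v i, h, zero_mul, Finsupp.zero_apply]

theorem exists_not_dvd_primitivePart {v : ι →₀ ℕ} (hv : v ≠ 0) {n : ℕ} (hn : n ≠ 1) :
    ∃ i, ¬ n ∣ primitivePart v i := by
  by_contra! h
  have : vectorContent v * n ∣ vectorContent v := by
    refine Finset.dvd_gcd fun i _ => ?_
    rw [← vectorContent_mul_primitivePart v i]
    exact mul_dvd_mul_left _ (h i)
  have h1 := Nat.le_of_dvd (vectorContent_pos hv) this
  have h2 := vectorContent_pos hv
  have h3 : n = 0 := by
    by_contra h0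
    have : 2 ≤ n := by omega
    nlinarith
  rw [h3, mul_zero, zero_dvd_iff] at this
  omega

/-- The product of the contents of the generators of a unimodular cone divides the index of
the lattice. -/
theorem prod_vectorContent_dvd_card {G : Type*} [AddCommGroup G] {φ : (ι →₀ ℕ) →+ G}
    {U : Finset (ι →₀ ℕ)} (hU : IndepVectors U) (hφ : ∀ v ∈ U, φ v = 0)
    (hbox : ∀ x ∈ latticeBox φ U, x = 0) : ∏ v ∈ U, vectorContent v ∣ Nat.card G := by
  classical
  let f : (U → ℤ) →+ G :=
    { toFun := fun a => ∑ v : U, a v • φ (primitivePart v.1)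
      map_zero' := by simp
      map_add' := fun a b => by simp [add_smul, Finset.sum_add_distrib] }
  let g : (U → ℤ) →+ (∀ v : U, ZMod (vectorContent v.1)) :=
    { toFun := fun a v => (a v : ZMod (vectorContent v.1))
      map_zero' := by ext; simp
      map_add' := fun a b => by ext; simp }
  have hzero : ∀ v ∈ U, (vectorContent v : ℤ) • φ (primitivePart v) = 0 := by
    intro v hv
    rw [natCast_zsmul, ← map_nsmul, vectorContent_smul_primitivePart, hφ v hv]
  -- Reducing an element of the kernel of `f` modulo the contents gives a lattice point whose
  -- coefficients `m v / vectorContent v` lie in `[0, 1)`. Unimodularity makes that point zero, so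
  -- every residue vanishes. The image of `f` in `G` thus has order the product of the contents.
  have hker : f.ker = g.ker := by
    ext a
    have hg : a ∈ g.ker ↔ ∀ v : U, (vectorContent v.1 : ℤ) ∣ a v := by
      rw [AddMonoidHom.mem_ker, funext_iff]
      exact forall_congr' fun v => ZMod.intCast_zmod_eq_zero_iff_dvd _ _
    rw [hg, AddMonoidHom.mem_ker]
    constructor
    · intro ha
      let b : (ι →₀ ℕ) → ℤ := fun v => if h : v ∈ U then a ⟨v, h⟩ else 0
      have hb : ∀ v : U, b v.1 = a v := fun v => by simp [b]
      have hpos : ∀ v ∈ U, (0 : ℤ) < vectorContent v :=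
        fun v hv => by exact_mod_cast vectorContent_pos (hU.ne_zero hv)
      let m : (ι →₀ ℕ) → ℕ := fun v => (b v % vectorContent v).toNat
      have hm : ∀ v ∈ U, (m v : ℤ) = b v % vectorContent v :=
        fun v hv => Int.toNat_of_nonneg (Int.emod_nonneg _ (hpos v hv).ne')
      have hmem : ∑ v ∈ U, m v • primitivePart v ∈ latticeBox φ U := by
        refine mem_latticeBox.2 ⟨?_, fun v => (m v : ℚ) / vectorContent v, ?_, ?_, ?_⟩
        · rw [map_sum]
          calc ∑ v ∈ U, φ (m v • primitivePart v) = ∑ v ∈ U, b v • φ (primitivePart v) := by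
                refine Finset.sum_congr rfl fun v hv => ?_
                rw [map_nsmul, ← natCast_zsmul, hm v hv, Int.emod_def, sub_smul, mul_comm,
                  mul_smul, hzero v hv, smul_zero, sub_zero]
            _ = f a := by
                rw [← Finset.sum_coe_sort]
                exact Finset.sum_congr rfl fun v _ => by rw [hb v]
            _ = 0 := ha
        · intro v _
          positivity
        · intro v hv
          have h1 : (m v : ℤ) < vectorContent v := by
            rw [hm v hv]; exact Int.emod_lt_of_pos _ (hpos v hv)
          have h2 : (m v : ℚ) < vectorContent v := by exact_mod_cast h1
          exact (div_lt_one (by exact_mod_cast hpos v hv)).2 h2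
        · intro i
          rw [Finsupp.finsetSum_apply]
          simp only [Finsupp.smul_apply, smul_eq_mul]
          push_cast
          refine Finset.sum_congr rfl fun v hv => ?_
          have h0 : (vectorContent v : ℚ) ≠ 0 := by exact_mod_cast (hpos v hv).ne'
          rw [← vectorContent_mul_primitivePart v i]
          push_cast
          field_simp
      have h0 := hbox _ hmem
      obtain ⟨-, c, -, -, hc⟩ := mem_latticeBox.1 hmem
      intro v
      have hv := v.2
      have := hU (fun v => (m v : ℚ) / vectorContent v) (fun i => by
        have := congrArg (fun x : ι →₀ ℕ => (x i : ℚ)) h0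
        simp only [Finsupp.finsetSum_apply, Finsupp.smul_apply, smul_eq_mul, Finsupp.zero_apply,
          Nat.cast_zero] at this
        push_cast at this
        rw [← this]
        refine Finset.sum_congr rfl fun v hv => ?_
        have h0 : (vectorContent v : ℚ) ≠ 0 := by exact_mod_cast (hpos v hv).ne'
        rw [← vectorContent_mul_primitivePart v i]
        push_cast
        field_simp) v hv
      have h0 : (vectorContent v.1 : ℚ) ≠ 0 := by exact_mod_cast (hpos v hv).ne'
      rw [div_eq_zero_iff, or_iff_left h0, Nat.cast_eq_zero] at this
      have h2 := hm v hv
      rw [this, Nat.cast_zero, hb v] at h2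
      exact Int.dvd_of_emod_eq_zero h2.symm
    · intro h
      refine Finset.sum_eq_zero fun v _ => ?_
      obtain ⟨k, hk⟩ := h v
      rw [hk, mul_comm, mul_smul, hzero v v.2, smul_zero]
  have hsurj : Function.Surjective g := by
    intro y
    choose a ha using fun v => ZMod.intCast_surjective (y v)
    exact ⟨a, funext ha⟩
  have hcard : Nat.card f.range = ∏ v ∈ U, vectorContent v := by
    rw [← AddSubgroup.index_ker, hker, AddSubgroup.index_ker, AddMonoidHom.range_eq_top.2 hsurj,
      AddSubgroup.card_top, Nat.card_pi]
    simp only [Nat.card_zmod]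
    exact Finset.prod_coe_sort U vectorContent
  rw [← hcard]
  exact AddSubgroup.card_addSubgroup_dvd_card _

end Content

/-! ### Gauss's lemma for primitive linear forms. -/

section Gauss

variable {ι : Type*}

/-- The linear form with coefficient vector `v`. -/
noncomputable def linearForm [Fintype ι] (v : ι →₀ ℕ) : MvPolynomial ι ℤ :=
  ∑ i, MvPolynomial.C (v i : ℤ) * MvPolynomial.X i

theorem coeff_linearForm [Fintype ι] (v : ι →₀ ℕ) (i : ι) :
    (linearForm v).coeff (Finsupp.single i 1) = v i := by
  classical
  simp only [linearForm, MvPolynomial.coeff_sum, MvPolynomial.coeff_C_mul, MvPolynomial.coeff_X,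
    Finsupp.single_left_inj one_ne_zero]
  simp

theorem linearForm_eq_content_mul [Fintype ι] (v : ι →₀ ℕ) :
    linearForm v = MvPolynomial.C (vectorContent v : ℤ) * linearForm (primitivePart v) := by
  rw [linearForm, linearForm, Finset.mul_sum]
  refine Finset.sum_congr rfl fun i _ => ?_
  rw [← mul_assoc, ← MvPolynomial.C_mul, ← Nat.cast_mul, vectorContent_mul_primitivePart]

theorem exists_smul_eq_map_intCast (F : MvPolynomial ι ℚ) :
    ∃ m : ℕ, 0 < m ∧ ∃ F₀ : MvPolynomial ι ℤ,
      MvPolynomial.C (m : ℚ) * F = MvPolynomial.map (Int.castRingHom ℚ) F₀ := by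
  induction F using MvPolynomial.induction_on with
  | C a =>
    refine ⟨a.den, a.den_pos, MvPolynomial.C a.num, ?_⟩
    rw [MvPolynomial.map_C, ← MvPolynomial.C_mul, mul_comm, Rat.mul_den_eq_num]
    simp
  | add F₁ F₂ h₁ h₂ =>
    obtain ⟨m₁, hm₁, G₁, hG₁⟩ := h₁
    obtain ⟨m₂, hm₂, G₂, hG₂⟩ := h₂
    refine ⟨m₁ * m₂, Nat.mul_pos hm₁ hm₂, MvPolynomial.C (m₂ : ℤ) * G₁ + MvPolynomial.C (m₁ : ℤ) * G₂,
      ?_⟩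
    rw [map_add, map_mul, map_mul, ← hG₁, ← hG₂]
    simp
    ring
  | mul_X F i h =>
    obtain ⟨m, hm, G, hG⟩ := h
    exact ⟨m, hm, G * MvPolynomial.X i, by rw [map_mul, ← hG, MvPolynomial.map_X, mul_assoc]⟩

/-- A prime `p` dividing the denominator `m` stays prime in `ℤ[X]` and does not divide the primitive
form. It therefore divides `F₀` and can be cancelled from `m`. -/
theorem exists_eq_map_of_mul_linearForm [Fintype ι] {v : ι →₀ ℕ} (hv : v ≠ 0)
    {F : MvPolynomial ι ℚ} {Z : MvPolynomial ι ℤ}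
    (h : F * MvPolynomial.map (Int.castRingHom ℚ) (linearForm (primitivePart v)) =
      MvPolynomial.map (Int.castRingHom ℚ) Z) :
    ∃ F₁ : MvPolynomial ι ℤ, F = MvPolynomial.map (Int.castRingHom ℚ) F₁ := by
  obtain ⟨m, hm, F₀, hF₀⟩ := exists_smul_eq_map_intCast F
  have hinj := MvPolynomial.map_injective (σ := ι) (Int.castRingHom ℚ) Int.cast_injective
  induction m using Nat.strong_induction_on generalizing F₀ with
  | _ m ih =>
    by_cases hm1 : m = 1
    · exact ⟨F₀, by rw [← hF₀, hm1]; simp⟩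
    obtain ⟨p, hp, k, rfl⟩ := Nat.exists_prime_and_dvd hm1
    have heq : F₀ * linearForm (primitivePart v) = MvPolynomial.C ((p * k : ℕ) : ℤ) * Z := by
      apply hinj
      rw [map_mul, map_mul, ← hF₀, ← h, MvPolynomial.map_C, mul_assoc]
      simp
    have hprime : Prime (MvPolynomial.C (p : ℤ) : MvPolynomial ι ℤ) :=
      (MvPolynomial.prime_C_iff ι).2 (Nat.prime_iff_prime_int.1 hp)
    have hdvd : (MvPolynomial.C (p : ℤ) : MvPolynomial ι ℤ) ∣
        F₀ * linearForm (primitivePart v) := by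
      rw [heq, Nat.cast_mul, MvPolynomial.C_mul, mul_assoc]
      exact dvd_mul_right _ _
    rcases hprime.dvd_or_dvd hdvd with ⟨F₁, rfl⟩ | hd
    · have hk : 0 < k := Nat.pos_of_mul_pos_left hm
      refine ih k ?_ hk F₁ ?_
      · nlinarith [hp.two_le]
      · have hp0 : (MvPolynomial.C (p : ℚ) : MvPolynomial ι ℚ) ≠ 0 := by
          simpa using hp.ne_zero
        apply mul_left_cancel₀ hp0
        rw [← mul_assoc, ← MvPolynomial.C_mul, ← Nat.cast_mul, hF₀, map_mul, MvPolynomial.map_C]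
        simp
    · obtain ⟨i, hi⟩ := exists_not_dvd_primitivePart hv hp.ne_one
      rw [MvPolynomial.C_dvd_iff_dvd_coeff] at hd
      have := hd (Finsupp.single i 1)
      rw [coeff_linearForm, Int.natCast_dvd_natCast] at this
      exact absurd this hi

end Gauss

/-! ### Exponential substitution and integrality of the Todd part. -/

section Exponential

variable {A : Type*} [CommRing A] [Algebra ℚ A]

theorem rescale_exp_sum {κ : Type*} (s : Finset κ) (f : κ → A) :
    PowerSeries.rescale (∑ i ∈ s, f i) (PowerSeries.exp A) =
      ∏ i ∈ s, PowerSeries.rescale (f i) (PowerSeries.exp A) := by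
  classical
  induction s using Finset.induction_on with
  | empty => simp
  | insert i s hi ih =>
    rw [Finset.sum_insert hi, Finset.prod_insert hi, ← ih, PowerSeries.exp_mul_exp_eq_exp_add]

theorem rescale_exp_pow (a : A) (k : ℕ) :
    PowerSeries.rescale a (PowerSeries.exp A) ^ k =
      PowerSeries.rescale (k * a) (PowerSeries.exp A) := by
  rw [← map_pow, PowerSeries.exp_pow_eq_rescale_exp, PowerSeries.rescale_rescale]

theorem rescale_bernoulliPowerSeries_mul (a : A) :
    PowerSeries.rescale a (bernoulliPowerSeries A) *
      (PowerSeries.rescale a (PowerSeries.exp A) - 1) = PowerSeries.C a * PowerSeries.X := by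
  have := congrArg (PowerSeries.rescale a) (bernoulliPowerSeries_mul_exp_sub_one A)
  rwa [map_mul, map_sub, map_one, PowerSeries.rescale_X] at this

/-- Evaluation of polynomials at the exponentials `exp (t X_i)`. -/
noncomputable def expHom (ι : Type*) :
    MvPolynomial ι ℤ →+* PowerSeries (MvPolynomial ι ℚ) :=
  MvPolynomial.eval₂Hom (Int.castRingHom _)
    fun i => PowerSeries.rescale (MvPolynomial.X i) (PowerSeries.exp _)

/-- The denominator `∏ (1 - X^v)`. -/
noncomputable def denomPoly {ι : Type*} (W : Multiset (ι →₀ ℕ)) : MvPolynomial ι ℤ :=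
  (W.map fun v => 1 - MvPolynomial.monomial v 1).prod

theorem denomPoly_add {ι : Type*} (W₁ W₂ : Multiset (ι →₀ ℕ)) :
    denomPoly (W₁ + W₂) = denomPoly W₁ * denomPoly W₂ := by
  simp [denomPoly]

theorem coe_denomPoly {ι : Type*} (U : Finset (ι →₀ ℕ)) :
    (denomPoly U.val : MvPowerSeries ι ℤ) = ∏ v ∈ U, (1 - MvPowerSeries.monomial v 1) := by
  rw [denomPoly, ← MvPolynomial.coeToMvPowerSeries.ringHom_apply, map_multiset_prod,
    Multiset.map_map]
  refine Finset.prod_congr rfl fun v _ => ?_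
  rw [Function.comp_apply, map_sub, map_one, MvPolynomial.coeToMvPowerSeries.ringHom_apply,
    MvPolynomial.coe_monomial]

variable {ι : Type*} [Fintype ι]

/-- The linear form with coefficient vector `v`, over `ℚ`. -/
noncomputable def rationalLinearForm (v : ι →₀ ℕ) : MvPolynomial ι ℚ :=
  MvPolynomial.map (Int.castRingHom ℚ) (linearForm v)

theorem rationalLinearForm_eq_sum (v : ι →₀ ℕ) :
    rationalLinearForm v = ∑ i, (v i : MvPolynomial ι ℚ) * MvPolynomial.X i := by
  simp [rationalLinearForm, linearForm]

theorem rationalLinearForm_eq_content_mul (v : ι →₀ ℕ) :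
    rationalLinearForm v = MvPolynomial.C (vectorContent v : ℚ) *
      MvPolynomial.map (Int.castRingHom ℚ) (linearForm (primitivePart v)) := by
  rw [rationalLinearForm, linearForm_eq_content_mul, map_mul, MvPolynomial.map_C]
  simp

theorem expHom_monomial (v : ι →₀ ℕ) :
    expHom ι (MvPolynomial.monomial v 1) =
      PowerSeries.rescale (rationalLinearForm v) (PowerSeries.exp _) := by
  rw [expHom, MvPolynomial.eval₂Hom_monomial, map_one, one_mul, rationalLinearForm_eq_sum,
    rescale_exp_sum, Finsupp.prod_fintype _ _ fun i => pow_zero _]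
  exact Finset.prod_congr rfl fun i _ => rescale_exp_pow _ _

/-- The power series `- l t / (exp (l t) - 1)` for the linear form `l` with coefficients `v`. -/
noncomputable def negTodd (v : ι →₀ ℕ) : PowerSeries (MvPolynomial ι ℚ) :=
  -PowerSeries.rescale (rationalLinearForm v) (bernoulliPowerSeries _)

theorem negTodd_mul (v : ι →₀ ℕ) :
    negTodd v * expHom ι (1 - MvPolynomial.monomial v 1) =
      PowerSeries.C (rationalLinearForm v) * PowerSeries.X := by
  rw [map_sub, map_one, expHom_monomial, negTodd, ← rescale_bernoulliPowerSeries_mul]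
  ring

/-- This replaces the expansion of `1 / ∏ (1 - X^v)`, which has poles: the linear forms and `t` are
kept on the other side instead of being inverted. It is why degree `d` of the quotient is read at
index `d + W.card`. -/
theorem prod_negTodd_mul (W : Multiset (ι →₀ ℕ)) :
    (W.map negTodd).prod * expHom ι (denomPoly W) =
      PowerSeries.C (W.map rationalLinearForm).prod * PowerSeries.X ^ W.card := by
  induction W using Multiset.induction_on with
  | empty => simp [denomPoly]
  | cons v W ih =>
    rw [denomPoly] at ih ⊢
    simp only [Multiset.map_cons, Multiset.prod_cons, Multiset.card_cons, map_mul, pow_succ]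
    rw [mul_mul_mul_comm, ih, negTodd_mul]
    ring

theorem prod_rationalLinearForm (W : Multiset (ι →₀ ℕ)) :
    (W.map rationalLinearForm).prod =
      MvPolynomial.C (((W.map vectorContent).prod : ℕ) : ℚ) *
        MvPolynomial.map (Int.castRingHom ℚ) (W.map fun v => linearForm (primitivePart v)).prod := by
  induction W using Multiset.induction_on with
  | empty => simp
  | cons v W ih =>
    simp only [Multiset.map_cons, Multiset.prod_cons, map_mul, ih, Nat.cast_mul]
    rw [rationalLinearForm_eq_content_mul]
    ring

theorem coeff_negTodd (v : ι →₀ ℕ) (a : ℕ) :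
    PowerSeries.coeff a (negTodd v) =
      MvPolynomial.map (Int.castRingHom ℚ) (-linearForm v ^ a) *
        MvPolynomial.C (bernoulli a / (a.factorial : ℚ)) := by
  rw [negTodd, map_neg, PowerSeries.coeff_rescale, bernoulliPowerSeries, PowerSeries.coeff_mk,
    rationalLinearForm, MvPolynomial.algebraMap_eq]
  simp

/-- The rational number `D` clears the denominators of the coefficients of degree `d + u` of the
Todd polynomials in `u` variables, for all `u ≤ n`. -/
def ClearsTodd (D : ℚ) (d n : ℕ) : Prop :=
  ∀ s : Multiset ℕ, s.card ≤ n → s.sum = d + s.card →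
    ∃ z : ℤ, D * (s.map fun a => bernoulli a / (a.factorial : ℚ)).prod = z

theorem exists_coeff_prod_negTodd {D : ℚ} {d n : ℕ} (hD : ClearsTodd D d n)
    (U : Finset (ι →₀ ℕ)) (hU : U.card ≤ n) :
    ∃ Z : MvPolynomial ι ℤ, MvPolynomial.C D *
      PowerSeries.coeff (d + U.card) (∏ v ∈ U, negTodd v) =
        MvPolynomial.map (Int.castRingHom ℚ) Z := by
  classical
  have key : ∀ a ∈ Finset.finsuppAntidiag U (d + U.card), ∃ Z : MvPolynomial ι ℤ,
      MvPolynomial.C D * ∏ v ∈ U, PowerSeries.coeff (a v) (negTodd v) =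
        MvPolynomial.map (Int.castRingHom ℚ) Z := by
    intro a ha
    obtain ⟨ha, -⟩ := Finset.mem_finsuppAntidiag.1 ha
    obtain ⟨z, hz⟩ := hD (U.val.map a) (by simpa using hU) (by simpa using ha)
    rw [Multiset.map_map] at hz
    refine ⟨(∏ v ∈ U, (-linearForm v ^ a v)) * MvPolynomial.C z, ?_⟩
    rw [map_mul, MvPolynomial.map_C, map_prod]
    simp only [coeff_negTodd, Finset.prod_mul_distrib, eq_intCast]
    rw [← hz, MvPolynomial.C_mul]
    rw [show (U.val.map ((fun a : ℕ => bernoulli a / (a.factorial : ℚ)) ∘ a)).prod =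
      ∏ v ∈ U, bernoulli (a v) / ((a v).factorial : ℚ) from rfl, map_prod]
    ring
  choose! Z hZ using key
  refine ⟨∑ a ∈ Finset.finsuppAntidiag U (d + U.card), Z a, ?_⟩
  rw [PowerSeries.coeff_prod, Finset.mul_sum, map_sum]
  exact Finset.sum_congr rfl hZ

/-- `g` is a rational function with denominator `∏ (1 - X^v)` whose Todd part, up to the product of
primitive linear forms, is integral after multiplication by `D`. -/
def HasIntegralToddPart (D : ℚ) (d : ℕ) (g : MvPowerSeries ι ℤ) : Prop :=
  ∃ (W : Multiset (ι →₀ ℕ)) (h Z : MvPolynomial ι ℤ), (∀ v ∈ W, v ≠ 0) ∧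
    (h : MvPowerSeries ι ℤ) = g * denomPoly W ∧
    MvPolynomial.C D * PowerSeries.coeff (d + W.card) (expHom ι h * (W.map negTodd).prod) =
      MvPolynomial.map (Int.castRingHom ℚ) Z * MvPolynomial.C (((W.map vectorContent).prod : ℕ) : ℚ)

theorem hasIntegralToddPart_zero (D : ℚ) (d : ℕ) :
    HasIntegralToddPart D d (0 : MvPowerSeries ι ℤ) :=
  ⟨0, 0, 0, by simp, by simp, by simp⟩

theorem HasIntegralToddPart.neg {D : ℚ} {d : ℕ} {g : MvPowerSeries ι ℤ}
    (hg : HasIntegralToddPart D d g) : HasIntegralToddPart D d (-g) := by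
  obtain ⟨W, h, Z, hW, hh, hZ⟩ := hg
  refine ⟨W, -h, -Z, hW, ?_, ?_⟩
  · rw [neg_mul, ← hh]
    exact map_neg MvPolynomial.coeToMvPowerSeries.ringHom h
  · rw [map_neg, neg_mul, map_neg, mul_neg, hZ, map_neg, neg_mul]

/-- Over the common denominator each summand gains the other's linear forms. The other's contents
enter the content product, its primitive forms enter `Z`, and its powers of `t` shift the
coefficient index. -/
theorem HasIntegralToddPart.add {D : ℚ} {d : ℕ} {g₁ g₂ : MvPowerSeries ι ℤ}
    (hg₁ : HasIntegralToddPart D d g₁) (hg₂ : HasIntegralToddPart D d g₂) :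
    HasIntegralToddPart D d (g₁ + g₂) := by
  obtain ⟨W₁, h₁, Z₁, hW₁, hh₁, hZ₁⟩ := hg₁
  obtain ⟨W₂, h₂, Z₂, hW₂, hh₂, hZ₂⟩ := hg₂
  refine ⟨W₁ + W₂, h₁ * denomPoly W₂ + h₂ * denomPoly W₁,
    Z₁ * (W₂.map fun v => linearForm (primitivePart v)).prod +
      Z₂ * (W₁.map fun v => linearForm (primitivePart v)).prod, ?_, ?_, ?_⟩
  · intro v hv
    rcases Multiset.mem_add.1 hv with hv | hv
    exacts [hW₁ v hv, hW₂ v hv]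
  · rw [MvPolynomial.coe_add, MvPolynomial.coe_mul, MvPolynomial.coe_mul, hh₁, hh₂, denomPoly_add,
      MvPolynomial.coe_mul]
    ring
  · have e : expHom ι (h₁ * denomPoly W₂ + h₂ * denomPoly W₁) * ((W₁ + W₂).map negTodd).prod =
        expHom ι h₁ * (W₁.map negTodd).prod *
            PowerSeries.C (W₂.map rationalLinearForm).prod * PowerSeries.X ^ W₂.card +
          expHom ι h₂ * (W₂.map negTodd).prod *
            PowerSeries.C (W₁.map rationalLinearForm).prod * PowerSeries.X ^ W₁.card := by
      rw [mul_assoc (expHom ι h₁ * _), mul_assoc (expHom ι h₂ * _), ← prod_negTodd_mul,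
        ← prod_negTodd_mul, Multiset.map_add, Multiset.prod_add, map_add, map_mul, map_mul]
      ring
    rw [e, map_add, Multiset.card_add, ← add_assoc, PowerSeries.coeff_mul_X_pow,
      add_right_comm, PowerSeries.coeff_mul_X_pow, PowerSeries.coeff_mul_C,
      PowerSeries.coeff_mul_C, mul_add, ← mul_assoc, ← mul_assoc, hZ₁, hZ₂,
      prod_rationalLinearForm, prod_rationalLinearForm]
    simp only [map_add, map_mul, Multiset.map_add, Multiset.prod_add, Nat.cast_mul]
    ring

/-- The box is `{0}`, so the numerator is `1`. `D` clears the Todd coefficients, and the index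
supplies the product of the contents times an integer `k`. -/
theorem hasIntegralToddPart_unimodular {G : Type*} [AddCommGroup G] {φ : (ι →₀ ℕ) →+ G}
    {D : ℚ} {d n : ℕ} (hD : ClearsTodd D d n) {U : Finset (ι →₀ ℕ)} (hU : IndepVectors U)
    (hφ : ∀ v ∈ U, φ v = 0) (hbox : ∀ x ∈ latticeBox φ U, x = 0) (hcard : U.card ≤ n) :
    HasIntegralToddPart (D * Nat.card G) d (slabSeries φ U ∅) := by
  obtain ⟨Z, hZ⟩ := exists_coeff_prod_negTodd hD U hcard
  obtain ⟨k, hk⟩ := prod_vectorContent_dvd_card hU hφ hbox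
  refine ⟨U.val, 1, MvPolynomial.C (k : ℤ) * Z, fun v hv => hU.ne_zero hv, ?_, ?_⟩
  · have h1 := slabSeries_mul_prod_eq_sum_latticeBox hU hφ
    have h0 : latticeBox φ U = {0} := by
      refine Finset.eq_singleton_iff_unique_mem.2 ⟨mem_latticeBox.2 ⟨map_zero φ, 0, ?_⟩, hbox⟩
      simp
    rw [h0, Finset.sum_singleton] at h1
    rw [MvPolynomial.coe_one, coe_denomPoly, h1]
    rfl
  · rw [map_one, one_mul, Finset.card_val]
    change _ * PowerSeries.coeff _ (∏ v ∈ U, negTodd v) = _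
    change _ = _ * MvPolynomial.C ((∏ v ∈ U, vectorContent v : ℕ) : ℚ)
    rw [hk, MvPolynomial.C_mul, mul_right_comm, hZ, map_mul, MvPolynomial.map_C]
    push_cast
    simp
    ring

theorem hasIntegralToddPart_slabSeries {G : Type*} [AddCommGroup G] {φ : (ι →₀ ℕ) →+ G}
    {D : ℚ} {d : ℕ} {S : Finset (ι →₀ ℕ)} (hD : ClearsTodd D d S.card) (hS : IndepVectors S)
    (hφ : ∀ v ∈ S, φ v = 0) : HasIntegralToddPart (D * Nat.card G) d (slabSeries φ S ∅) := by
  refine AddSubgroup.closure_induction (p := fun g _ => HasIntegralToddPart (D * Nat.card G) d g)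
    ?_ (hasIntegralToddPart_zero _ _) (fun _ _ _ _ h₁ h₂ => h₁.add h₂) (fun _ _ h => h.neg)
    (slabSeries_mem_closure_unimodular _ S rfl hS hφ)
  rintro g ⟨U, hU, hUφ, hbox, hcard, rfl⟩
  exact hasIntegralToddPart_unimodular hD hU hUφ hbox hcard

end Exponential

/-! ### From cone series to integral box sums. -/

section AxisCone

/-- This is the generating function of the Bernoulli polynomials at `y / q`, rescaled by `q a`. -/
theorem rescale_exp_mul_bernoulliPowerSeries {A : Type*} [CommRing A] [Algebra ℚ A] (a : A)
    {q : ℕ} (hq : 0 < q) (y : ℕ) :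
    PowerSeries.rescale (y * a) (PowerSeries.exp A) *
      PowerSeries.rescale (q * a) (bernoulliPowerSeries A) =
    PowerSeries.mk fun k => a ^ k * algebraMap ℚ A
      ((q : ℚ) ^ k * ((Polynomial.bernoulli k).eval ((y : ℚ) / q) / (k.factorial : ℚ))) := by
  set t : A := algebraMap ℚ A ((y : ℚ) / q) with ht
  have h1 : (PowerSeries.mk fun n => Polynomial.aeval t
      ((1 / n.factorial : ℚ) • Polynomial.bernoulli n)) =
      PowerSeries.rescale t (PowerSeries.exp A) * bernoulliPowerSeries A := by
    have h := congrArg (· * bernoulliPowerSeries A) (Polynomial.bernoulli_generating_function t)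
    simp only [mul_assoc] at h
    rw [mul_comm (PowerSeries.exp A - 1), bernoulliPowerSeries_mul_exp_sub_one,
      mul_comm _ PowerSeries.X] at h
    exact PowerSeries.X_mul_cancel h
  have h2 := congrArg (PowerSeries.rescale ((q : A) * a)) h1
  have h3 : t * (q * a) = y * a := by
    have : (q : ℚ) ≠ 0 := by exact_mod_cast hq.ne'
    rw [ht, ← mul_assoc, ← map_natCast (algebraMap ℚ A) q, ← map_mul, div_mul_cancel₀ _ this,
      map_natCast]
  rw [map_mul, PowerSeries.rescale_rescale, h3] at h2
  rw [← h2, PowerSeries.rescale_mk]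
  congr 1
  ext k
  rw [ht, Polynomial.aeval_algebraMap_apply, map_mul, map_pow, map_natCast, map_smul,
    Polynomial.aeval_def, Polynomial.eval₂_eq_eval_map, Algebra.algebraMap_self, Polynomial.map_id,
    smul_eq_mul, one_div, inv_mul_eq_div]
  ring

theorem exists_eq_map_of_mul_prod_linearForm {ι : Type*} [Fintype ι] (W : Multiset (ι →₀ ℕ))
    (hW : ∀ v ∈ W, v ≠ 0) {F : MvPolynomial ι ℚ} {Z : MvPolynomial ι ℤ}
    (h : F * MvPolynomial.map (Int.castRingHom ℚ)
      (W.map fun v => linearForm (primitivePart v)).prod =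
      MvPolynomial.map (Int.castRingHom ℚ) Z) :
    ∃ F₁ : MvPolynomial ι ℤ, F = MvPolynomial.map (Int.castRingHom ℚ) F₁ := by
  induction W using Multiset.induction_on generalizing F Z with
  | empty => exact ⟨Z, by simpa using h⟩
  | cons v W ih =>
    rw [Multiset.map_cons, Multiset.prod_cons, map_mul, ← mul_assoc] at h
    obtain ⟨F₂, hF₂⟩ := ih (fun u hu => hW u (Multiset.mem_cons_of_mem hu)) h
    exact exists_eq_map_of_mul_linearForm (hW v (Multiset.mem_cons_self _ _)) hF₂

/-- The cone series has two presentations as a fraction: over `S` with the box as numerator, and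
over the `W` of the decomposition. Comparing their Todd parts leaves primitive forms as the only
denominators, and Gauss's lemma removes those of `W`. -/
theorem exists_eq_map_coeff_latticeBox {ι : Type*} [Fintype ι] {G : Type*} [AddCommGroup G] {φ : (ι →₀ ℕ) →+ G}
    {D : ℚ} {d : ℕ} {S : Finset (ι →₀ ℕ)} (hD : ClearsTodd D d S.card) (hS : IndepVectors S)
    (hφ : ∀ v ∈ S, φ v = 0) :
    ∃ Z : MvPolynomial ι ℤ, MvPolynomial.C (D * Nat.card G / (∏ v ∈ S, vectorContent v : ℕ)) *
      PowerSeries.coeff (d + S.card) (expHom ι (∑ x ∈ latticeBox φ S, MvPolynomial.monomial x 1) *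
        ∏ v ∈ S, negTodd v) = MvPolynomial.map (Int.castRingHom ℚ) Z := by
  obtain ⟨W, h, Z, hW, hh, hZ⟩ := hasIntegralToddPart_slabSeries hD hS hφ
  set box : MvPolynomial ι ℤ := ∑ x ∈ latticeBox φ S, MvPolynomial.monomial x 1 with hbox
  set F := PowerSeries.coeff (d + S.card) (expHom ι box * ∏ v ∈ S, negTodd v) with hF
  -- Both fractions represent the same power series, so cross-multiplication gives an identity of
  -- polynomials to which `expHom` applies.
  have h1 : h * denomPoly S.val = box * denomPoly W := by
    apply MvPolynomial.coe_injective
    rw [MvPolynomial.coe_mul, MvPolynomial.coe_mul, hh, coe_denomPoly, mul_right_comm,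
      slabSeries_mul_prod_eq_sum_latticeBox hS hφ]
    congr 1
    rw [hbox, ← MvPolynomial.coeToMvPowerSeries.ringHom_apply, map_sum]
    refine Finset.sum_congr rfl fun x _ => ?_
    rw [MvPolynomial.coeToMvPowerSeries.ringHom_apply, MvPolynomial.coe_monomial]
  have h2 : expHom ι h * (W.map negTodd).prod *
        PowerSeries.C (S.val.map rationalLinearForm).prod * PowerSeries.X ^ S.card =
      expHom ι box * (∏ v ∈ S, negTodd v) *
        PowerSeries.C (W.map rationalLinearForm).prod * PowerSeries.X ^ W.card := by
    have h3 := prod_negTodd_mul S.val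
    have h4 := congrArg (expHom ι) h1
    rw [map_mul, map_mul] at h4
    rw [Finset.card_val] at h3
    rw [mul_assoc (expHom ι h * _), ← h3, mul_assoc (expHom ι box * _), ← prod_negTodd_mul,
      show (S.val.map negTodd).prod = ∏ v ∈ S, negTodd v from rfl]
    linear_combination ((W.map negTodd).prod * ∏ v ∈ S, negTodd v) * h4
  have h3 := congrArg (PowerSeries.coeff (d + W.card + S.card)) h2
  rw [PowerSeries.coeff_mul_X_pow, add_right_comm, PowerSeries.coeff_mul_X_pow,
    PowerSeries.coeff_mul_C, PowerSeries.coeff_mul_C, ← hF] at h3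
  have h4 := congrArg (MvPolynomial.C (D * Nat.card G) * ·) h3
  simp only [← mul_assoc] at h4
  rw [hZ, prod_rationalLinearForm, prod_rationalLinearForm,
    show (S.val.map vectorContent).prod = ∏ v ∈ S, vectorContent v from rfl] at h4
  have hWc : (MvPolynomial.C (((W.map vectorContent).prod : ℕ) : ℚ) : MvPolynomial ι ℚ) ≠ 0 := by
    rw [Ne, MvPolynomial.C_eq_zero, Nat.cast_eq_zero, Multiset.prod_eq_zero_iff]
    simp only [Multiset.mem_map, not_exists, not_and]
    exact fun v hv => (vectorContent_pos (hW v hv)).ne'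
  have hSc : ((∏ v ∈ S, vectorContent v : ℕ) : ℚ) ≠ 0 := by
    rw [Nat.cast_ne_zero, Finset.prod_ne_zero_iff]
    exact fun v hv => (vectorContent_pos (hS.ne_zero hv)).ne'
  refine exists_eq_map_of_mul_prod_linearForm W hW
    (Z := Z * (S.val.map fun v => linearForm (primitivePart v)).prod) ?_
  have hSc' : (MvPolynomial.C ((∏ v ∈ S, vectorContent v : ℕ) : ℚ) : MvPolynomial ι ℚ) ≠ 0 := by
    rwa [Ne, MvPolynomial.C_eq_zero]
  apply mul_left_cancel₀ hSc'
  apply mul_left_cancel₀ hWc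
  have h5 : (MvPolynomial.C ((∏ v ∈ S, vectorContent v : ℕ) : ℚ) : MvPolynomial ι ℚ) *
      MvPolynomial.C (D * Nat.card G / (∏ v ∈ S, vectorContent v : ℕ)) =
      MvPolynomial.C (D * Nat.card G) := by
    rw [← MvPolynomial.C_mul, mul_div_cancel₀ _ hSc]
  rw [map_mul]
  linear_combination (MvPolynomial.C (((W.map vectorContent).prod : ℕ) : ℚ) * F *
    MvPolynomial.map (Int.castRingHom ℚ) (W.map fun v => linearForm (primitivePart v)).prod) * h5 -
      h4
-- Coordinate faces of the orthant, with generators `q e_i`.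
variable {ι : Type*}

theorem coeff_prod_X_pow_mul_C {R : Type*} [CommRing R] (B : Finset ι) {a m : ι →₀ ℕ}
    (ha : a.support ⊆ B) (b : ι → R) [Decidable (a = m)] :
    (∏ i ∈ B, (MvPolynomial.X i ^ a i * MvPolynomial.C (b i))).coeff m =
      if a = m then ∏ i ∈ B, b i else 0 := by
  classical
  have : ∏ i ∈ B, (MvPolynomial.X i : MvPolynomial ι R) ^ a i = MvPolynomial.monomial a 1 := by
    rw [MvPolynomial.monomial_eq, MvPolynomial.C_1, one_mul,
      Finsupp.prod_of_support_subset _ ha _ fun i _ => pow_zero _]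
  rw [Finset.prod_mul_distrib, this, ← map_prod, mul_comm, MvPolynomial.coeff_C_mul,
    MvPolynomial.coeff_monomial, mul_ite, mul_one, mul_zero]
  congr

open Classical in
/-- The vectors `q e_i` for `i ∈ B`. -/
noncomputable def axisVectors (q : ℕ) (B : Finset ι) : Finset (ι →₀ ℕ) :=
  B.image fun i => Finsupp.single i q

theorem sum_axisVectors {M : Type*} [AddCommMonoid M] {q : ℕ} (hq : 0 < q) (B : Finset ι)
    (f : (ι →₀ ℕ) → M) : ∑ v ∈ axisVectors q B, f v = ∑ i ∈ B, f (Finsupp.single i q) := by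
  classical
  rw [axisVectors, Finset.sum_image]
  exact fun i _ j _ h => (Finsupp.single_left_inj hq.ne').1 h

theorem prod_axisVectors {M : Type*} [CommMonoid M] {q : ℕ} (hq : 0 < q) (B : Finset ι)
    (f : (ι →₀ ℕ) → M) : ∏ v ∈ axisVectors q B, f v = ∏ i ∈ B, f (Finsupp.single i q) := by
  classical
  rw [axisVectors, Finset.prod_image]
  exact fun i _ j _ h => (Finsupp.single_left_inj hq.ne').1 h

theorem card_axisVectors {q : ℕ} (hq : 0 < q) (B : Finset ι) : (axisVectors q B).card = B.card := by
  classical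
  rw [axisVectors, Finset.card_image_of_injective]
  exact fun i j h => (Finsupp.single_left_inj hq.ne').1 h

theorem sum_axisVectors_mul [DecidableEq ι] {q : ℕ} (hq : 0 < q) (B : Finset ι)
    (c : (ι →₀ ℕ) → ℚ) (i : ι) : ∑ v ∈ axisVectors q B, c v * (v i : ℚ) =
      if i ∈ B then c (Finsupp.single i q) * q else 0 := by
  rw [sum_axisVectors hq]
  simp [Finsupp.single_apply]

theorem indepVectors_axisVectors {q : ℕ} (hq : 0 < q) (B : Finset ι) :
    IndepVectors (axisVectors q B) := by
  classical
  intro c hc v hv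
  obtain ⟨i, hi, rfl⟩ := Finset.mem_image.1 hv
  have := hc i
  rw [sum_axisVectors_mul hq, if_pos hi, mul_eq_zero, or_iff_left (by exact_mod_cast hq.ne')] at this
  exact this

variable [Fintype ι]

theorem mem_latticeBox_axisVectors {G : Type*} [AddCommGroup G] {φ : (ι →₀ ℕ) →+ G} {q : ℕ}
    (hq : 0 < q) (B : Finset ι) {x : ι →₀ ℕ} : x ∈ latticeBox φ (axisVectors q B) ↔
      φ x = 0 ∧ (∀ i ∈ B, x i < q) ∧ ∀ i ∉ B, x i = 0 := by
  classical
  have hq' : (0 : ℚ) < q := by exact_mod_cast hq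
  rw [mem_latticeBox]
  constructor
  · rintro ⟨hx, c, -, h1, hc⟩
    refine ⟨hx, fun i hi => ?_, fun i hi => ?_⟩
    · have h := hc i
      rw [sum_axisVectors_mul hq, if_pos hi] at h
      have h2 := h1 (Finsupp.single i q) (Finset.mem_image_of_mem _ hi)
      have : (x i : ℚ) < q := by nlinarith
      exact_mod_cast this
    · have h := hc i
      rw [sum_axisVectors_mul hq, if_neg hi] at h
      exact_mod_cast h.symm
  · rintro ⟨hx, h1, h2⟩
    refine ⟨hx, fun v => ∑ i, if v = Finsupp.single i q then (x i : ℚ) / q else 0, ?_, ?_, ?_⟩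
    · intro v _
      refine Finset.sum_nonneg fun i _ => ?_
      split_ifs <;> positivity
    · intro v hv
      obtain ⟨i, hi, rfl⟩ := Finset.mem_image.1 hv
      simp only [Finsupp.single_left_inj hq.ne', Finset.sum_ite_eq, Finset.mem_univ, if_true]
      rw [div_lt_one hq']
      exact_mod_cast h1 i hi
    · intro i
      rw [sum_axisVectors_mul hq]
      simp only [Finsupp.single_left_inj hq.ne', Finset.sum_ite_eq, Finset.mem_univ, if_true]
      split_ifs with hi
      · rw [div_mul_cancel₀ _ hq'.ne']
      · rw [h2 i hi, Nat.cast_zero]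

theorem vectorContent_single {q : ℕ} (i : ι) : vectorContent (Finsupp.single i q) = q := by
  classical
  apply Nat.dvd_antisymm
  · have := Finset.gcd_dvd (f := fun j => Finsupp.single i q j) (Finset.mem_univ i)
    simpa [vectorContent] using this
  · refine Finset.dvd_gcd fun j _ => ?_
    rw [Finsupp.single_apply]
    split_ifs <;> simp

theorem rationalLinearForm_single {q : ℕ} (i : ι) :
    rationalLinearForm (Finsupp.single i q) = (q : MvPolynomial ι ℚ) * MvPolynomial.X i := by
  classical
  rw [rationalLinearForm_eq_sum, Finset.sum_eq_single i]
  · simp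
  · intro j _ hj
    simp [hj.symm]
  · simp

theorem expHom_monomial_mul_negTodd {q : ℕ} (hq : 0 < q) (B : Finset ι) {x : ι →₀ ℕ}
    (hx : ∀ i ∉ B, x i = 0) :
    expHom ι (MvPolynomial.monomial x 1) * ∏ v ∈ axisVectors q B, negTodd v =
      ∏ i ∈ B, -PowerSeries.mk fun k => MvPolynomial.X i ^ k * MvPolynomial.C
        ((q : ℚ) ^ k * ((Polynomial.bernoulli k).eval ((x i : ℚ) / q) / (k.factorial : ℚ))) := by
  rw [expHom_monomial, rationalLinearForm_eq_sum,
    ← Finset.sum_subset (Finset.subset_univ B) fun i _ hi => by rw [hx i hi]; simp,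
    rescale_exp_sum, prod_axisVectors hq, ← Finset.prod_mul_distrib]
  refine Finset.prod_congr rfl fun i _ => ?_
  rw [negTodd, rationalLinearForm_single, mul_neg, rescale_exp_mul_bernoulliPowerSeries _ hq]
  rfl

/-- The monomial `∏ X_i ^ r i` isolates the Bernoulli sum. Its factor `q ^ (d + B.card)` loses `q ^
B.card` to the contents of the generators, leaving `q ^ d`. -/
theorem exists_int_sum_latticeBox {G : Type*} [AddCommGroup G] {φ : (ι →₀ ℕ) →+ G}
    {q : ℕ} (hq : 0 < q) (hφ : ∀ i, φ (Finsupp.single i q) = 0) (B : Finset ι) {D : ℚ} {d : ℕ}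
    (hD : ClearsTodd D d B.card) (r : ι → ℕ) (hr : ∑ i ∈ B, r i = d + B.card) :
    ∃ z : ℤ, D * Nat.card G * (q : ℚ) ^ d * ∑ x ∈ latticeBox φ (axisVectors q B),
      ∏ i ∈ B, (Polynomial.bernoulli (r i)).eval ((x i : ℚ) / q) / ((r i).factorial : ℚ) = z := by
  classical
  have hq' : (q : ℚ) ≠ 0 := by exact_mod_cast hq.ne'
  obtain ⟨Z, hZ⟩ := exists_eq_map_coeff_latticeBox (φ := φ) (d := d)
    ((card_axisVectors hq B).symm ▸ hD) (indepVectors_axisVectors hq B) (fun v hv => by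
      obtain ⟨i, -, rfl⟩ := Finset.mem_image.1 hv
      exact hφ i)
  rw [card_axisVectors hq, prod_axisVectors hq] at hZ
  simp only [vectorContent_single, Finset.prod_const] at hZ
  set m : ι →₀ ℕ := Finsupp.equivFunOnFinite.symm fun i => if i ∈ B then r i else 0 with hm
  have hmB : ∀ i ∈ B, m i = r i := fun i hi => by simp [hm, hi]
  have hmem : m ∈ Finset.finsuppAntidiag B (d + B.card) := by
    refine Finset.mem_finsuppAntidiag.2 ⟨?_, fun i hi => ?_⟩
    · rw [← hr]; exact Finset.sum_congr rfl hmB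
    · by_contra h
      simp [hm, h] at hi
  have hcoeff := congrArg (MvPolynomial.coeff m) hZ
  rw [MvPolynomial.coeff_C_mul, MvPolynomial.coeff_map, map_sum, Finset.sum_mul, map_sum,
    MvPolynomial.coeff_sum] at hcoeff
  have hx : ∀ x ∈ latticeBox φ (axisVectors q B),
      MvPolynomial.coeff m (PowerSeries.coeff (d + B.card)
        (expHom ι (MvPolynomial.monomial x 1) * ∏ v ∈ axisVectors q B, negTodd v)) =
      (-1) ^ B.card * (q : ℚ) ^ (d + B.card) *
        ∏ i ∈ B, (Polynomial.bernoulli (r i)).eval ((x i : ℚ) / q) / ((r i).factorial : ℚ) := by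
    intro x hx
    rw [expHom_monomial_mul_negTodd hq B ((mem_latticeBox_axisVectors hq B).1 hx).2.2,
      PowerSeries.coeff_prod, MvPolynomial.coeff_sum, Finset.sum_eq_single m]
    · simp only [map_neg, PowerSeries.coeff_mk, ← mul_neg, ← MvPolynomial.C_neg]
      rw [coeff_prod_X_pow_mul_C B (Finset.mem_finsuppAntidiag.1 hmem).2, if_pos rfl,
        Finset.prod_congr rfl fun i hi => by rw [hmB i hi, neg_eq_neg_one_mul],
        Finset.prod_mul_distrib, Finset.prod_mul_distrib, Finset.prod_const,
        Finset.prod_pow_eq_pow_sum, hr]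
      ring
    · intro a ha hne
      simp only [map_neg, PowerSeries.coeff_mk, ← mul_neg, ← MvPolynomial.C_neg]
      rw [coeff_prod_X_pow_mul_C B (Finset.mem_finsuppAntidiag.1 ha).2, if_neg hne]
    · exact fun h => absurd hmem h
  rw [Finset.sum_congr rfl hx, ← Finset.mul_sum] at hcoeff
  refine ⟨(-1) ^ B.card * Z.coeff m, ?_⟩
  push_cast
  rw [← eq_intCast (Int.castRingHom ℚ), ← hcoeff]
  push_cast
  have h1 : ((-1 : ℚ) ^ B.card) * (-1) ^ B.card = 1 := by rw [← mul_pow]; norm_num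
  rw [pow_add]
  field_simp
  linear_combination (-(D * Nat.card G * ∑ x ∈ latticeBox φ (axisVectors q B),
      ∏ i ∈ B, (Polynomial.bernoulli (r i)).eval ((x i : ℚ) / q) / ((r i).factorial : ℚ))) * h1

end AxisCone

/-! ### Todd denominators, faces and Dedekind sums. -/

section DedekindSums

theorem coeff_toddPolynomial {n N : ℕ} {a : Fin n →₀ ℕ} (ha : ∑ i, a i = N) :
    (toddPolynomial n N).coeff a =
      (-1) ^ N * ∏ i : Fin n, bernoulli (a i) / ((a i).factorial : ℚ) := by
  classical
  rw [toddPolynomial, MvPolynomial.coeff_sum]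
  simp only [MvPolynomial.coeff_monomial]
  rw [Finset.sum_ite_eq', if_pos]
  exact Finset.mem_finsuppAntidiag.2 ⟨ha, Finset.subset_univ _⟩

theorem exists_int_toddDenominator_mul_coeff (n N : ℕ) (a : Fin n →₀ ℕ) :
    ∃ z : ℤ, (toddDenominator N n : ℚ) * (toddPolynomial n N).coeff a = z := by
  by_cases h : a ∈ (toddPolynomial n N).support
  · obtain ⟨k, hk⟩ : ((toddPolynomial n N).coeff a).den ∣ toddDenominator N n :=
      Finset.dvd_lcm (f := fun a => ((toddPolynomial n N).coeff a).den) h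
    refine ⟨k * ((toddPolynomial n N).coeff a).num, ?_⟩
    rw [hk]
    push_cast
    rw [mul_comm (Rat.den _ : ℚ), mul_assoc, Rat.den_mul_eq_num]
  · exact ⟨0, by rw [MvPolynomial.notMem_support_iff.1 h]; simp⟩

theorem exists_int_toddDenominator_mul_multiset {n N : ℕ} (s : Multiset ℕ) (hs : s.card = n)
    (hN : s.sum = N) :
    ∃ z : ℤ, (toddDenominator N n : ℚ) *
      (s.map fun a => bernoulli a / (a.factorial : ℚ)).prod = z := by
  obtain ⟨l, rfl⟩ := Quot.exists_rep s
  change l.length = n at hs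
  subst hs
  let a : Fin l.length →₀ ℕ := Finsupp.equivFunOnFinite.symm l.get
  have hsum : ∑ i, a i = N := by
    rw [← hN]
    change ∑ i, l.get i = l.sum
    rw [← List.sum_ofFn, List.ofFn_get]
  obtain ⟨z, hz⟩ := exists_int_toddDenominator_mul_coeff l.length N a
  rw [coeff_toddPolynomial hsum] at hz
  have hprod : ∏ i, bernoulli (a i) / ((a i).factorial : ℚ) =
      (l.map fun a => bernoulli a / (a.factorial : ℚ)).prod := by
    change ∏ i, bernoulli (l.get i) / ((l.get i).factorial : ℚ) = _
    rw [← List.prod_ofFn]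
    congr 1
    conv_rhs => rw [← List.ofFn_get l, List.map_ofFn]
    rfl
  have h1 : ((-1 : ℚ) ^ N) * (-1) ^ N = 1 := by rw [← mul_pow]; norm_num
  refine ⟨(-1) ^ N * z, ?_⟩
  change (toddDenominator N l.length : ℚ) *
    (l.map fun a => bernoulli a / (a.factorial : ℚ)).prod = _
  rw [← hprod]
  push_cast
  rw [← hz]
  linear_combination (-(toddDenominator N l.length : ℚ) *
    ∏ i, bernoulli (a i) / ((a i).factorial : ℚ)) * h1

/-- Pad `s` with ones to `k + b` entries: each contributes `B_1 = -1/2` and raises both degree and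
number of variables by one. Of the resulting factors `1/2`, `k` are kept and the other `c` are
multiplied away. -/
theorem clearsTodd_toddDenominator (d k b : ℕ) :
    ClearsTodd ((toddDenominator (d + (k + b)) (k + b) : ℚ) / 2 ^ k) d b := by
  intro s hs hsum
  obtain ⟨c, hc⟩ := Nat.exists_eq_add_of_le hs
  obtain ⟨z, hz⟩ := exists_int_toddDenominator_mul_multiset (n := k + b) (N := d + (k + b))
    (s + Multiset.replicate (k + c) 1) (by simp; omega) (by simp [hsum]; omega)
  rw [Multiset.map_add, Multiset.prod_add, Multiset.map_replicate, Multiset.prod_replicate,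
    bernoulli_one] at hz
  refine ⟨(-1) ^ (k + c) * 2 ^ c * z, ?_⟩
  push_cast
  rw [← hz, Nat.factorial_one, Nat.cast_one, div_one, neg_div, neg_eq_neg_one_mul (1 / 2 : ℚ),
    mul_pow (-1 : ℚ), div_pow,
    one_pow]
  have h1 : ((-1 : ℚ) ^ (k + c)) * (-1) ^ (k + c) = 1 := by rw [← mul_pow]; norm_num
  have h2 : (2 : ℚ) ^ c * (1 / 2 ^ (k + c)) = 1 / 2 ^ k := by rw [pow_add]; field_simp
  generalize (s.map fun a => bernoulli a / (a.factorial : ℚ)).prod = P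
  generalize (toddDenominator (d + (k + b)) (k + b) : ℚ) = D
  linear_combination (-(D * P * (2 : ℚ) ^ c * (1 / 2 ^ (k + c)))) * h1 - D * P * h2

theorem periodicBernoulli_natCast_div {q x : ℕ} (hq : 0 < q) (hx : x < q) (r : ℕ) :
    periodicBernoulli r ((x : ℚ) / q) = (if r = 1 ∧ x = 0 then 1 / 2 else 0) +
      (Polynomial.bernoulli r).eval ((x : ℚ) / q) := by
  have hq' : (0 : ℚ) < q := by exact_mod_cast hq
  have hf : Int.fract ((x : ℚ) / q) = (x : ℚ) / q :=
    Int.fract_eq_self.2 ⟨by positivity, (div_lt_one hq').2 (by exact_mod_cast hx)⟩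
  have h0 : (x : ℚ) / q = 0 ↔ x = 0 := by
    rw [div_eq_zero_iff, or_iff_left hq'.ne', Nat.cast_eq_zero]
  rw [periodicBernoulli, hf]
  simp only [h0]
  split_ifs with h
  · rw [h0.2 h.2, h.1, Polynomial.bernoulli_eval_zero, bernoulli_one]
    norm_num
  · rw [zero_add]

theorem periodicBernoulli_emod {q : ℕ} (hq : 0 < q) (r : ℕ) (a : ℤ) :
    periodicBernoulli r ((a : ℚ) / q) =
      periodicBernoulli r ((((a % (q : ℤ)).toNat : ℕ) : ℚ) / q) := by
  have hq' : (q : ℤ) ≠ 0 := by exact_mod_cast hq.ne'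
  have hq'' : (q : ℚ) ≠ 0 := by exact_mod_cast hq.ne'
  have h1 : (((a % (q : ℤ)).toNat : ℕ) : ℚ) = ((a % (q : ℤ) : ℤ) : ℚ) := by
    rw [← Int.cast_natCast, Int.toNat_of_nonneg (Int.emod_nonneg _ hq')]
  have h2 : Int.fract ((a : ℚ) / q) = Int.fract (((a % (q : ℤ) : ℤ) : ℚ) / q) := by
    rw [Int.fract_eq_fract]
    refine ⟨a / q, ?_⟩
    rw [Int.emod_def]
    push_cast
    field_simp
    ring
  rw [h1, periodicBernoulli, periodicBernoulli, h2]

/-- The linear form `k ↦ p_1 k_1 + ⋯ + p_m k_m - k_{m+1}` modulo `q`. -/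
def dedekindForm {m : ℕ} (q : ℕ) (p : Fin m → ℤ) : (Fin (m + 1) →₀ ℕ) →+ ZMod q where
  toFun k := ((∑ i, p i * (k i.castSucc : ℤ) - k (Fin.last m) : ℤ) : ZMod q)
  map_zero' := by simp
  map_add' k l := by
    rw [← Int.cast_add]
    congr 1
    simp only [Finsupp.add_apply, Nat.cast_add, mul_add, Finset.sum_add_distrib]
    ring

theorem dedekindForm_single {m : ℕ} (q : ℕ) (p : Fin m → ℤ) (i : Fin (m + 1)) :
    dedekindForm q p (Finsupp.single i q) = 0 := by
  rw [show Finsupp.single i q = q • Finsupp.single i 1 by simp, map_nsmul, nsmul_eq_mul,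
    CharP.cast_eq_zero, zero_mul]

theorem dedekindForm_eq_zero_iff {m q : ℕ} (hq : 0 < q) (p : Fin m → ℤ) {x : Fin (m + 1) →₀ ℕ}
    (hx : x (Fin.last m) < q) :
    dedekindForm q p x = 0 ↔
      ((∑ i, p i * (x i.castSucc : ℤ)) % (q : ℤ)).toNat = x (Fin.last m) := by
  have hq' : (q : ℤ) ≠ 0 := by exact_mod_cast hq.ne'
  change ((∑ i, p i * (x i.castSucc : ℤ) - x (Fin.last m) : ℤ) : ZMod q) = 0 ↔ _
  rw [Int.cast_sub, sub_eq_zero, ZMod.intCast_eq_intCast_iff']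
  have h1 := Int.emod_nonneg (∑ i, p i * (x i.castSucc : ℤ)) hq'
  have h2 : (x (Fin.last m) : ℤ) % q = x (Fin.last m) :=
    Int.emod_eq_of_lt (by positivity) (by exact_mod_cast hx)
  rw [h2]
  omega

/-- A box point is determined by its first `m` coordinates, since the last one is the residue forced
by `dedekindForm`. -/
theorem generalizedDedekindSum_eq_sum_latticeBox {m q : ℕ} (hq : 0 < q) (r : Fin (m + 1) → ℕ)
    (p : Fin m → ℤ) : generalizedDedekindSum r q p =
      ∑ x ∈ latticeBox (dedekindForm q p) (axisVectors q Finset.univ),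
        ∏ i, periodicBernoulli (r i) ((x i : ℚ) / q) := by
  have hq' : (q : ℤ) ≠ 0 := by exact_mod_cast hq.ne'
  let e : (Fin m → Fin q) → (Fin (m + 1) →₀ ℕ) := fun k => Finsupp.equivFunOnFinite.symm
    (Fin.snoc (fun i => (k i : ℕ)) ((∑ i, p i * ((k i : ℕ) : ℤ)) % (q : ℤ)).toNat)
  have he1 : ∀ k i, e k (Fin.castSucc i) = k i := fun k i => by simp [e]
  have he2 : ∀ k, e k (Fin.last m) = ((∑ i, p i * ((k i : ℕ) : ℤ)) % (q : ℤ)).toNat :=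
    fun k => by simp [e]
  have hlt : ∀ a : ℤ, (a % (q : ℤ)).toNat < q := by
    intro a
    have h1 := Int.emod_nonneg a hq'
    have h2 := Int.emod_lt_of_pos a (by exact_mod_cast hq : (0 : ℤ) < q)
    omega
  -- The remainder modulo `q` in the inverse map only supplies the bound for `Fin q`; on the box it
  -- changes nothing.
  refine Finset.sum_nbij' e (fun x i => ⟨x i.castSucc % q, Nat.mod_lt _ hq⟩) ?_ ?_ ?_ ?_ ?_
  · intro k _
    have hl : e k (Fin.last m) < q := by rw [he2]; exact hlt _
    refine (mem_latticeBox_axisVectors hq _).2 ⟨?_, fun i _ => ?_, by simp⟩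
    · rw [dedekindForm_eq_zero_iff hq p hl, he2]
      simp only [he1]
    · induction i using Fin.lastCases with
      | last => exact hl
      | cast i => rw [he1]; exact (k i).2
  · intro x _
    exact Finset.mem_univ _
  · intro k _
    funext i
    ext
    simp only [he1]
    exact Nat.mod_eq_of_lt (k i).2
  · intro x hx
    obtain ⟨h0, h1, -⟩ := (mem_latticeBox_axisVectors hq _).1 hx
    have h2 : ∀ i, x i % q = x i := fun i => Nat.mod_eq_of_lt (h1 i (Finset.mem_univ i))
    ext i
    induction i using Fin.lastCases with
    | last =>
      rw [he2]
      simp only [h2]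
      exact (dedekindForm_eq_zero_iff hq p (h1 _ (Finset.mem_univ _))).1 h0
    | cast i => rw [he1]; exact h2 _
  · intro k _
    rw [Fin.prod_univ_castSucc, he2, ← periodicBernoulli_emod hq]
    simp only [he1]
    push_cast
    rfl

/-- The corrections at `A` restrict the sum to the face `x i = 0` for `i ∈ A` and contribute `(1/2)
^ A.card`. As `r i = 1` on `A`, degree and dimension drop equally, so the face has the same `d`. -/
theorem exists_int_sum_latticeBox_subset {m q : ℕ} (hq : 0 < q) (r : Fin (m + 1) → ℕ)
    (p : Fin m → ℤ) {d : ℕ} (hd : ∑ i, r i = d + (m + 1)) (A : Finset (Fin (m + 1))) :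
    ∃ z : ℤ, (toddDenominator (d + (m + 1)) (m + 1) : ℚ) / (∏ i, ((r i).factorial : ℚ)) *
      (q : ℚ) ^ (d + 1) *
        ∑ x ∈ latticeBox (dedekindForm q p) (axisVectors q Finset.univ),
          (∏ i ∈ A, if r i = 1 ∧ x i = 0 then (1 / 2 : ℚ) else 0) *
            ∏ i ∈ Finset.univ \ A, (Polynomial.bernoulli (r i)).eval ((x i : ℚ) / q) = z := by
  classical
  by_cases hA : ∀ i ∈ A, r i = 1
  swap
  · push Not at hA
    obtain ⟨i, hi, hri⟩ := hA
    refine ⟨0, ?_⟩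
    rw [Finset.sum_eq_zero fun x _ => by
      rw [Finset.prod_eq_zero hi (if_neg fun h => hri h.1), zero_mul], mul_zero, Int.cast_zero]
  set B := Finset.univ \ A with hB
  have hdisj : ∀ f : Fin (m + 1) → ℕ, ∑ i ∈ B, f i + ∑ i ∈ A, f i = ∑ i, f i :=
    fun f => Finset.sum_sdiff (Finset.subset_univ A)
  have hcard : A.card + B.card = m + 1 := by
    have := hdisj fun _ => 1
    simp at this
    omega
  have hr : ∑ i ∈ B, r i = d + B.card := by
    have h1 := hdisj r
    rw [Finset.sum_congr rfl hA, hd] at h1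
    simp at h1
    omega
  obtain ⟨z, hz⟩ := exists_int_sum_latticeBox hq (dedekindForm_single q p) B
    (hcard ▸ clearsTodd_toddDenominator d A.card B.card) r hr
  refine ⟨z, ?_⟩
  have hsum : ∑ x ∈ latticeBox (dedekindForm q p) (axisVectors q Finset.univ),
        (∏ i ∈ A, if r i = 1 ∧ x i = 0 then (1 / 2 : ℚ) else 0) *
          ∏ i ∈ B, (Polynomial.bernoulli (r i)).eval ((x i : ℚ) / q) =
      (1 / 2) ^ A.card * ∑ x ∈ latticeBox (dedekindForm q p) (axisVectors q B),
        ∏ i ∈ B, (Polynomial.bernoulli (r i)).eval ((x i : ℚ) / q) := by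
    rw [Finset.mul_sum]
    symm
    apply Finset.sum_subset_zero_on_sdiff
    · intro x hx
      obtain ⟨h0, h1, h2⟩ := (mem_latticeBox_axisVectors hq _).1 hx
      refine (mem_latticeBox_axisVectors hq _).2 ⟨h0, fun i _ => ?_, by simp⟩
      by_cases hi : i ∈ B
      · exact h1 i hi
      · rw [h2 i hi]; exact hq
    · intro x hx
      obtain ⟨hx1, hx2⟩ := Finset.mem_sdiff.1 hx
      obtain ⟨h0, h1, -⟩ := (mem_latticeBox_axisVectors hq _).1 hx1
      have : ∃ i ∈ A, x i ≠ 0 := by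
        by_contra! h
        refine hx2 ((mem_latticeBox_axisVectors hq _).2
          ⟨h0, fun i _ => h1 i (Finset.mem_univ i), fun i hi => h i ?_⟩)
        simpa [hB] using hi
      obtain ⟨i, hi, hxi⟩ := this
      rw [Finset.prod_eq_zero hi (if_neg fun h => hxi h.2), zero_mul]
    · intro x hx
      obtain ⟨-, -, h2⟩ := (mem_latticeBox_axisVectors hq _).1 hx
      rw [Finset.prod_congr rfl fun i hi => if_pos ⟨hA i hi, h2 i (by simp [hB, hi])⟩,
        Finset.prod_const]
  have hfact : ∏ i, ((r i).factorial : ℚ) = ∏ i ∈ B, ((r i).factorial : ℚ) := by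
    rw [← Finset.prod_sdiff (Finset.subset_univ A)]
    have : ∏ i ∈ A, ((r i).factorial : ℚ) = 1 :=
      Finset.prod_eq_one fun i hi => by simp [hA i hi]
    rw [this, mul_one]
  rw [hsum, hfact, ← hz, Nat.card_zmod]
  simp only [Finset.prod_div_distrib]
  rw [← Finset.sum_div, one_div, inv_pow]
  field_simp
  ring

end DedekindSums

/-! ### Assembly over the faces. -/

theorem mainTheorem6 (m : ℕ) (r : Fin (m + 1) → ℕ) (hr : ∀ i, 0 < r i)
    (N : ℕ) (hN : N = ∑ i, r i)
    (q : ℕ) (p : Fin m → ℤ) (hqp : (q, p) ∈ dedekindParameters m) :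
    ∃ z : ℤ,
      (toddDenominator N (m + 1) : ℚ) / (∏ i, ((r i).factorial : ℚ)) *
          (q : ℚ) ^ ((N : ℤ) - ((m + 1 : ℕ) : ℤ) + 1) *
          generalizedDedekindSum r q p = (z : ℚ) := by
  classical
  have hq : 0 < q := hqp.1
  have hle : m + 1 ≤ N := by
    rw [hN]
    calc m + 1 = ∑ _i : Fin (m + 1), 1 := by simp
      _ ≤ _ := Finset.sum_le_sum fun i _ => hr i
  obtain ⟨d, hd⟩ := Nat.exists_eq_add_of_le' hle
  have hexp : (N : ℤ) - ((m + 1 : ℕ) : ℤ) + 1 = ((d + 1 : ℕ) : ℤ) := by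
    rw [hd]; push_cast; ring
  rw [hexp, zpow_natCast, generalizedDedekindSum_eq_sum_latticeBox hq]
  -- Each factor is a Bernoulli value plus a possible `1/2`; in the expanded product `A` marks the
  -- factors where the correction is chosen.
  have hprod : ∀ x ∈ latticeBox (dedekindForm q p) (axisVectors q Finset.univ),
      ∏ i, periodicBernoulli (r i) ((x i : ℚ) / q) = ∑ A ∈ Finset.univ.powerset,
        (∏ i ∈ A, if r i = 1 ∧ x i = 0 then (1 / 2 : ℚ) else 0) *
          ∏ i ∈ Finset.univ \ A, (Polynomial.bernoulli (r i)).eval ((x i : ℚ) / q) := by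
    intro x hx
    obtain ⟨-, h1, -⟩ := (mem_latticeBox_axisVectors hq _).1 hx
    rw [← Finset.prod_add]
    exact Finset.prod_congr rfl fun i hi => periodicBernoulli_natCast_div hq (h1 i hi) (r i)
  choose z hz using exists_int_sum_latticeBox_subset hq r p (hN.symm.trans hd)
  refine ⟨∑ A ∈ Finset.univ.powerset, z A, ?_⟩
  rw [Finset.sum_congr rfl hprod, Finset.sum_comm, Finset.mul_sum, Int.cast_sum]
  refine Finset.sum_congr rfl fun A _ => ?_
  rw [← hz A, hd]
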